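/- Let $n,d\ge 1$ and let $Y=(Y_i^{(j)})$, $1\le i\le n$, $0\le j\le d$, be an $n\times(d+1)$ array of random variables; column $0$ is the outcome of interest and columns $1,\dots,d$ are auxiliary outcomes. Assume *sub-Gaussian proportionality*: there are positive semidefinite matrices $\Lambda_n=(\lambda_{i,i'})_{i,i'=1}^n$ and $\Gamma=(\gamma_{j,j'})_{j,j'=0}^d$ with $\gamma_{0,0}=1$, a vector $\tau$, and a random matrix $Z$ whose entries are independent, mean-zero and sub-Gaussian with parameter $M\ge1$ (that is, $\mathbb E\,e^{tZ_{ij}}\le e^{M^2t^2/2}$ for all $t\in\mathbb R$), such that $$Y=\mathbf 1\tau^\top+\Lambda_n^{1/2}Z\,\Gamma^{1/2},\qquad \operatorname{Cov}(Y_i^{(j)},Y_{i'}^{(j')})=\lambda_{i,i'}\gamma_{j,j'}.$$ Assume *row sparsity*: for some $0\le q<1$ and $\kappa_n$, $\max_{i}\sum_{i'=1}^n|\lambda_{i,i'}|^q\le\kappa_n$, with the convention $0^0=0$. Suppose $0<\underline\lambda\le\lambda_{i,i}\le\bar\lambda$ for all $i$ and $0<\underline\gamma\le\gamma_{j,j}\le\bar\gamma$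 for $1\le j\le d$. Let $\Gamma_d=(\gamma_{j,j'})_{j,j'=1}^d$ and $\Omega_d=\Gamma_d^{1/2}\operatorname{diag}(1/\gamma_{1,1},\dots,1/\gamma_{d,d})\Gamma_d^{1/2}$. With the outcomes centered at their means, $y_i^{(j)}=Y_i^{(j)}-\tau_j$, put $$\hat\gamma_j=\frac1n\sum_{i=1}^n\bigl(y_i^{(j)}\bigr)^2\quad(0\le j\le d),\qquad \hat\lambda_{i,i'}=\frac1d\sum_{j=1}^d\bigl(\hat\gamma_j^{-1/2}y_i^{(j)}\bigr)\bigl(\hat\gamma_j^{-1/2}y_{i'}^{(j)}\bigr).$$ For $0<\phi<1$ set $$\varphi_{n,d}=\Bigl(\frac1d\|\Omega_d\|_{\mathrm F}+\sqrt{\kappa_n/n}\Bigr)\log^{3/2}(nd/\phi).$$ There exist constants $0<c<1$ and $C>0$, depending only on $M,\underline\lambda,\bar\lambda,\underline\gamma,\bar\gamma$, such that if $\varphi_{n,d}<c$, then with probability greater than $1-C\phi$ the estimators are well defined ($\hat\gamma_j>0$ for $1\le j\le d$) and $$\max_{i,i'\in\{1,\dots,n\}}|\hat\gamma_0\hat\lambda_{i,i'}-\lambda_{i,i'}|\le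 C\varphi_{n,d}.$$ -/

import Mathlib

open MeasureTheory ProbabilityTheory

noncomputable section

namespace Consistency

open scoped Matrix MatrixOrder Matrix.Norms.L2Operator in
/-- The square root `A^{1/2}` of a positive semidefinite real matrix: the unique positive
semidefinite matrix whose square is `A`. -/
def matSqrt {m : ℕ} (A : Matrix (Fin m) (Fin m) ℝ) : Matrix (Fin m) (Fin m) ℝ :=
  CFC.sqrt A

open scoped Matrix MatrixOrder Matrix.Norms.L2Operator in
/-- `matSqrt` is a positive semidefinite square root. -/
theorem matSqrt_spec {m : ℕ} (A : Matrix (Fin m) (Fin m) ℝ) (hA : A.PosSemidef) :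
    (matSqrt A).PosSemidef ∧ matSqrt A * matSqrt A = A :=
  ⟨Matrix.nonneg_iff_posSemidef.mp (CFC.sqrt_nonneg A),
    CFC.sqrt_mul_sqrt_self A (Matrix.nonneg_iff_posSemidef.mpr hA)⟩

/-- Sub-Gaussian proportionality for the `n × (d+1)` array of outcomes `Y i j`, where column `0`
is the outcome of interest and columns `1, …, d` are the auxiliary outcomes:
`Y = 1 τᵀ + Λ^{1/2} Z Γ^{1/2}` with positive semidefinite `Λ`, `Γ`, where `Z` has independent,
mean-zero entries that are sub-Gaussian with parameter `M`, the covariances of the outcomes are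
`Cov(Y i j, Y i' j') = λ_{i i'} γ_{j j'}`, and the scale is fixed by `γ_{0 0} = 1`. -/
structure SubGaussianProportional {Ω : Type*} [MeasurableSpace Ω] (μ : Measure Ω) {n d : ℕ}
    (M : ℝ) (Λ : Matrix (Fin n) (Fin n) ℝ) (Γ : Matrix (Fin (d + 1)) (Fin (d + 1)) ℝ)
    (τ : Fin (d + 1) → ℝ) (Z Y : Fin n → Fin (d + 1) → Ω → ℝ) : Prop where
  posSemidef_Λ : Λ.PosSemidef
  posSemidef_Γ : Γ.PosSemidef
  γ_zero_zero : Γ 0 0 = 1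
  measurable_Z : ∀ i j, Measurable (Z i j)
  indep_Z : iIndepFun (fun p : Fin n × Fin (d + 1) => Z p.1 p.2) μ
  mean_Z : ∀ i j, ∫ ω, Z i j ω ∂μ = 0
  subGaussian_Z : ∀ i j, HasSubgaussianMGF (Z i j) (Real.toNNReal (M ^ 2)) μ
  representation : ∀ i j ω, Y i j ω =
    τ j + (matSqrt Λ * Matrix.of (fun a b => Z a b ω) * matSqrt Γ) i j
  covariance_Y : ∀ i i' j j', covariance (Y i j) (Y i' j') μ = Λ i i' * Γ j j'

/-- Row sparsity: `max_i ∑_{i'} |λ_{i i'}|^q ≤ κ`, with the convention `0 ^ 0 = 0`. -/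
def RowSparse {n : ℕ} (Λ : Matrix (Fin n) (Fin n) ℝ) (q κ : ℝ) : Prop :=
  ∀ i, ∑ i', (if Λ i i' = 0 then 0 else |Λ i i'| ^ q) ≤ κ

/-- The block `(γ_{j j'})_{j, j' = 1}^d` that belongs to the auxiliary outcomes. -/
def auxBlock {d : ℕ} (Γ : Matrix (Fin (d + 1)) (Fin (d + 1)) ℝ) : Matrix (Fin d) (Fin d) ℝ :=
  Γ.submatrix Fin.succ Fin.succ

/-- `Ω_d = Γ_d^{1/2} diag(1/γ_{1 1}, …, 1/γ_{d d}) Γ_d^{1/2}`, for the auxiliary outcomes. -/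
def outcomeCorr {d : ℕ} (Γ : Matrix (Fin (d + 1)) (Fin (d + 1)) ℝ) : Matrix (Fin d) (Fin d) ℝ :=
  matSqrt (auxBlock Γ) * Matrix.diagonal (fun j => 1 / auxBlock Γ j j) * matSqrt (auxBlock Γ)

/-- The rate `((1/d) ‖Ω_d‖_F + √(κ/n)) log^{3/2}(n d / φ)`. -/
def rate (n d : ℕ) (Γ : Matrix (Fin (d + 1)) (Fin (d + 1)) ℝ) (κ φ : ℝ) : ℝ :=
  ((1 / (d : ℝ)) * √(∑ j, ∑ j', outcomeCorr Γ j j' ^ 2) + √(κ / (n : ℝ))) *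
    Real.log ((n : ℝ) * (d : ℝ) / φ) ^ (3 / 2 : ℝ)

/-- `γ̂_j = (1/n) ∑_i (y_i^{(j)})²`, for a data array `y` of mean-zero outcomes. -/
def gammaHat {n d : ℕ} (y : Fin n → Fin (d + 1) → ℝ) (j : Fin (d + 1)) : ℝ :=
  (1 / (n : ℝ)) * ∑ i, y i j ^ 2

/-- The normalized outcome `γ̂_j^{-1/2} y_i^{(j)}`. -/
def normalized {n d : ℕ} (y : Fin n → Fin (d + 1) → ℝ) (i : Fin n) (j : Fin (d + 1)) : ℝ :=
  gammaHat y j ^ (-(1 / 2) : ℝ) * y i j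

/-- `λ̂_{i i'}`: the average over the auxiliary outcomes `1, …, d` of the products of the
normalized outcomes of the units `i` and `i'`. -/
def lambdaHat {n d : ℕ} (y : Fin n → Fin (d + 1) → ℝ) (i i' : Fin n) : ℝ :=
  (1 / (d : ℝ)) * ∑ j : Fin d, normalized y i j.succ * normalized y i' j.succ

end Consistency

end

/-! ### Exponential moments of quadratic forms in sub-Gaussian variables. -/

noncomputable section
namespace Consistency

open scoped ENNReal NNReal

variable {Ω : Type*} {mΩ : MeasurableSpace Ω} {μ : Measure Ω}

/-! The unknown scale cancels in a ratio. Every `γ̂_j / γ_{jj}`, including `j = 0` where `γ_{00} =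
1`, concentrates around the same number `tr Λ / n`. The oracle average `lambdaTilde`, normalized by
the true `γ_{jj}`, concentrates around `Λ`. Replacing `γ_{jj}` by `γ̂_j` and multiplying by `γ̂_0`
changes each summand by the factor `γ̂_0 γ_{jj} / γ̂_j`, which is close to `1`; `estimator_error`
makes this deterministic.

Both concentration statements concern quadratic forms in `Z` whose coefficients are a Kronecker
product of a `Λ`-part and a `Γ`-part, so the Frobenius norm factorizes (`quadStat_tail`). It is at
most a multiple of `√(κ/n)` for `γ̂_j`, by row sparsity, and of `‖Ω_d‖_F / d` for `lambdaTilde`. A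
union bound at level `2 log (nd/φ)` finishes the proof.

The probabilistic input is `hansonWright`, with exponential tails at the Frobenius scale. The
diagonal part is a sum of independent centered squares. The off-diagonal part is folded into a
strictly triangular form, whose coordinates are integrated out one at a time against a quadratic
compensator; the compensator is a sum of squares of sub-Gaussian linear forms and is controlled by
Jensen's inequality. -/

lemma lintegral_exp_mul_le {X : Ω → ℝ} {c : ℝ≥0} (h : HasSubgaussianMGF X c μ) (t : ℝ) :
    ∫⁻ ω, ENNReal.ofReal (Real.exp (t * X ω)) ∂μ ≤ ENNReal.ofReal (Real.exp (c * t ^ 2 / 2)) := by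
  rw [← ofReal_integral_eq_lintegral_ofReal (h.integrable_exp_mul t)
    (ae_of_all _ fun _ => (Real.exp_pos _).le)]
  exact ENNReal.ofReal_le_ofReal (h.mgf_le t)

/-- For `a ≤ 1/4` the tilted standard density has exponent at most `-x²/4`, that of variance `2`;
the normalizing constants differ by `√2 ≤ 2`. -/
lemma lintegral_exp_sq_gaussianReal_le {a : ℝ} (ha : a ≤ 1 / 4) :
    ∫⁻ x, ENNReal.ofReal (Real.exp (a * x ^ 2)) ∂(gaussianReal 0 1) ≤ 2 := by
  rw [gaussianReal_of_var_ne_zero 0 one_ne_zero,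
    lintegral_withDensity_eq_lintegral_mul _ (measurable_gaussianPDF 0 1) (by fun_prop)]
  calc ∫⁻ x, (gaussianPDF 0 1 * fun x => ENNReal.ofReal (Real.exp (a * x ^ 2))) x
      ≤ ∫⁻ x, 2 * gaussianPDF 0 2 x := by
        refine lintegral_mono fun x => ?_
        rw [Pi.mul_apply, gaussianPDF, gaussianPDF, ← ENNReal.ofReal_mul (gaussianPDFReal_nonneg _ _ _),
          show (2 : ℝ≥0∞) = ENNReal.ofReal 2 by simp,
          ← ENNReal.ofReal_mul (p := 2) (by norm_num)]
        refine ENNReal.ofReal_le_ofReal ?_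
        simp only [gaussianPDFReal, NNReal.coe_one, NNReal.coe_ofNat, sub_zero, mul_one]
        rw [mul_assoc, ← Real.exp_add, ← mul_assoc]
        refine mul_le_mul ?_ (Real.exp_le_exp.mpr (by nlinarith [sq_nonneg x])) (Real.exp_pos _).le
          (by positivity)
        have h1 : √(2 * Real.pi * 2) = √(2 * Real.pi) * √2 := Real.sqrt_mul (by positivity) _
        have h2 : √2 ≤ 2 := by
          rw [Real.sqrt_le_left (by norm_num)]; norm_num
        have h3 : 0 < √(2 * Real.pi) := by positivity
        have h4 : 0 < √(2 : ℝ) := by positivity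
        rw [h1, ← div_eq_mul_inv, inv_eq_one_div, div_le_div_iff₀ h3 (by positivity)]
        nlinarith
    _ = 2 := by
        rw [lintegral_const_mul _ (measurable_gaussianPDF 0 2),
          lintegral_gaussianPDF_eq_one 0 (by norm_num), mul_one]

/-- The square of a sub-Gaussian variable has a bounded exponential moment. -/
lemma lintegral_exp_sq_le [SFinite μ] {X : Ω → ℝ} {c : ℝ≥0} (h : HasSubgaussianMGF X c μ)
    {r : ℝ} (hr : 0 ≤ r) (hrc : r * c ≤ 1 / 4) :
    ∫⁻ ω, ENNReal.ofReal (Real.exp (r * X ω ^ 2)) ∂μ ≤ 2 := by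
  -- Gaussian linearization of the square: after exchanging the integrals, the sub-Gaussian bound
  -- applies for each fixed `g` and leaves `exp (r c g²)`.
  have key : ∀ x : ℝ, ENNReal.ofReal (Real.exp (r * x ^ 2)) =
      ∫⁻ g, ENNReal.ofReal (Real.exp (√(2 * r) * x * g)) ∂(gaussianReal 0 1) := by
    intro x
    rw [← ofReal_integral_eq_lintegral_ofReal (integrable_exp_mul_gaussianReal _)
      (ae_of_all _ fun _ => (Real.exp_pos _).le)]
    congr 1
    have := congrFun (mgf_fun_id_gaussianReal (μ := 0) (v := 1)) (√(2 * r) * x)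
    rw [mgf] at this
    rw [this]
    congr 1
    rw [mul_pow, Real.sq_sqrt (by positivity)]
    simp
    ring
  simp_rw [key]
  rw [lintegral_lintegral_swap]
  · refine le_trans (lintegral_mono fun g => ?_)
      (lintegral_exp_sq_gaussianReal_le hrc)
    calc ∫⁻ ω, ENNReal.ofReal (Real.exp (√(2 * r) * X ω * g)) ∂μ
        = ∫⁻ ω, ENNReal.ofReal (Real.exp (√(2 * r) * g * X ω)) ∂μ := by
          simp_rw [mul_right_comm]
      _ ≤ _ := lintegral_exp_mul_le h _
      _ = _ := by
          rw [mul_pow, Real.sq_sqrt (by positivity)]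
          congr 2
          ring
  · refine (ENNReal.measurable_ofReal.comp Real.measurable_exp).comp_aemeasurable ?_
    exact (((h.aemeasurable.comp_fst).const_mul _).mul measurable_snd.aemeasurable)

/-- Exponential supermartingale bound for a strictly triangular quadratic form. -/
lemma lintegral_pi_exp_triangular_le {c : ℝ} : ∀ {N : ℕ} (ν : Fin N → Measure ℝ)
    [∀ i, IsProbabilityMeasure (ν i)]
    (_ : ∀ i t, ∫⁻ x, ENNReal.ofReal (Real.exp (t * x)) ∂(ν i) ≤
      ENNReal.ofReal (Real.exp (c * t ^ 2 / 2)))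
    (b : Fin N → Fin N → ℝ) (_ : ∀ i j, j ≤ i → b i j = 0),
    ∫⁻ z, ENNReal.ofReal (Real.exp (∑ i, (z i * (∑ j, b i j * z j)
      - c / 2 * (∑ j, b i j * z j) ^ 2))) ∂(Measure.pi ν) ≤ 1
  | 0, ν, _, _, b, _ => by simp
  | N + 1, ν, _, hν, b, hb => by
    have ih := lintegral_pi_exp_triangular_le (fun i : Fin N => ν i.succ) (fun i => hν i.succ)
      (fun i j => b i.succ j.succ) (fun i j hij => hb _ _ (Fin.succ_le_succ_iff.mpr hij))
    have hmp := measurePreserving_piFinSuccAbove ν 0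
    have hmeas : Measurable fun z : Fin (N + 1) → ℝ =>
        ENNReal.ofReal (Real.exp (∑ i, (z i * (∑ j, b i j * z j)
          - c / 2 * (∑ j, b i j * z j) ^ 2))) := by fun_prop
    rw [← hmp.symm.lintegral_comp_emb (MeasurableEquiv.measurableEmbedding _)]
    refine (lintegral_prod_symm' _ (hmeas.comp (MeasurableEquiv.measurable _))).trans_le ?_
    refine le_trans (lintegral_mono fun z => ?_) ih
    set w : ℝ := ∑ j : Fin N, b 0 j.succ * z j with hw
    set R : ℝ := ∑ i, (z i * (∑ j, b (Fin.succ i) (Fin.succ j) * z j)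
      - c / 2 * (∑ j, b (Fin.succ i) (Fin.succ j) * z j) ^ 2) with hR
    have hcons : ∀ x : ℝ, (MeasurableEquiv.piFinSuccAbove (fun _ : Fin (N + 1) => ℝ) 0).symm (x, z)
        = Fin.cons x z := fun x => by
      simp [MeasurableEquiv.piFinSuccAbove]
      rfl
    -- Triangularity makes column `0` of `b` vanish, so the coordinate `0` enters only linearly,
    -- with slope `w`. Its integral is at most `exp (c w² / 2)`, exactly what the compensator
    -- removes.
    have hsplit : ∀ x : ℝ, (∑ i, ((Fin.cons x z : Fin (N + 1) → ℝ) i *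
          (∑ j, b i j * (Fin.cons x z : Fin (N + 1) → ℝ) j)
        - c / 2 * (∑ j, b i j * (Fin.cons x z : Fin (N + 1) → ℝ) j) ^ 2))
        = w * x + (R - c / 2 * w ^ 2) := by
      intro x
      simp only [Fin.sum_univ_succ, Fin.cons_zero, Fin.cons_succ, hb _ 0 (Fin.zero_le _), zero_mul,
        zero_add]
      rw [← hw, ← hR]
      ring
    calc ∫⁻ x, ENNReal.ofReal (Real.exp _) ∂(ν 0)
        = ∫⁻ x, ENNReal.ofReal (Real.exp (w * x)) *
            ENNReal.ofReal (Real.exp (R - c / 2 * w ^ 2)) ∂(ν 0) := by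
          refine lintegral_congr fun x => ?_
          rw [← ENNReal.ofReal_mul (Real.exp_pos _).le, ← Real.exp_add, ← hsplit x, hcons x]
      _ = (∫⁻ x, ENNReal.ofReal (Real.exp (w * x)) ∂(ν 0)) *
            ENNReal.ofReal (Real.exp (R - c / 2 * w ^ 2)) := lintegral_mul_const _ (by fun_prop)
      _ ≤ ENNReal.ofReal (Real.exp (c * w ^ 2 / 2)) *
            ENNReal.ofReal (Real.exp (R - c / 2 * w ^ 2)) := by gcongr; exact hν 0 w
      _ = ENNReal.ofReal (Real.exp R) := by
          rw [← ENNReal.ofReal_mul (Real.exp_pos _).le, ← Real.exp_add]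
          congr 2
          ring

lemma lintegral_exp_triangular_le [IsProbabilityMeasure μ] {N : ℕ} {X : Fin N → Ω → ℝ} {c : ℝ≥0}
    (hm : ∀ i, Measurable (X i)) (hind : iIndepFun X μ)
    (hsub : ∀ i, HasSubgaussianMGF (X i) c μ)
    (b : Fin N → Fin N → ℝ) (hb : ∀ i j, j ≤ i → b i j = 0) :
    ∫⁻ ω, ENNReal.ofReal (Real.exp (∑ i, (X i ω * (∑ j, b i j * X j ω)
      - c / 2 * (∑ j, b i j * X j ω) ^ 2))) ∂μ ≤ 1 := by
  have hmap := (iIndepFun_iff_map_fun_eq_pi_map fun i => (hm i).aemeasurable).mp hind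
  have : ∀ i, IsProbabilityMeasure (μ.map (X i)) :=
    fun i => Measure.isProbabilityMeasure_map (hm i).aemeasurable
  have h := lintegral_pi_exp_triangular_le (c := c) (fun i => μ.map (X i)) (fun i t => by
    rw [lintegral_map (by fun_prop) (hm i)]
    exact lintegral_exp_mul_le (hsub i) t) b hb
  rwa [← hmap, lintegral_map (by fun_prop) (by fun_prop)] at h

/-- Jensen's inequality for the exponential of a sum of squares. -/
lemma lintegral_exp_sum_sq_le [IsProbabilityMeasure μ] {ι : Type*} [Fintype ι] {W : ι → Ω → ℝ}
    {v : ι → ℝ≥0} (hW : ∀ i, HasSubgaussianMGF (W i) (v i) μ) {r : ℝ} (hr : 0 ≤ r)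
    (hrv : r * ∑ i, (v i : ℝ) ≤ 1 / 4) :
    ∫⁻ ω, ENNReal.ofReal (Real.exp (r * ∑ i, W i ω ^ 2)) ∂μ ≤ 2 := by
  set V : ℝ := ∑ i, (v i : ℝ) with hV
  have hV0 : 0 ≤ V := Finset.sum_nonneg fun i _ => (v i).coe_nonneg
  -- Variables with parameter `0` vanish almost surely, so the junk value of a division by `v i = 0`
  -- below is harmless.
  have hzero : ∀ᵐ ω ∂μ, ∀ i, v i = 0 → W i ω = 0 := by
    rw [ae_all_iff]
    intro i
    by_cases hi : v i = 0
    · have h0 := hW i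
      rw [hi] at h0
      filter_upwards [h0.ae_eq_zero_of_hasSubgaussianMGF_zero] with ω hω _
      exact hω
    · exact ae_of_all _ fun _ h => absurd h hi
  rcases hV0.eq_or_lt with h0 | hpos
  · have hv0 : ∀ i, v i = 0 := fun i => by
      have := (Finset.sum_eq_zero_iff_of_nonneg fun i _ => (v i).coe_nonneg).mp h0.symm i (Finset.mem_univ i)
      exact NNReal.coe_eq_zero.mp this
    calc ∫⁻ ω, ENNReal.ofReal (Real.exp (r * ∑ i, W i ω ^ 2)) ∂μ
        = ∫⁻ _, 1 ∂μ := by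
          refine lintegral_congr_ae ?_
          filter_upwards [hzero] with ω hω
          simp [hω _ (hv0 _)]
      _ ≤ 2 := by simp
  · have hsum : ∑ i, (v i : ℝ) / V = 1 := by
      rw [← Finset.sum_div]; exact div_self hpos.ne'
    calc ∫⁻ ω, ENNReal.ofReal (Real.exp (r * ∑ i, W i ω ^ 2)) ∂μ
        ≤ ∫⁻ ω, ∑ i, ENNReal.ofReal (v i / V) *
            ENNReal.ofReal (Real.exp (r * V / v i * W i ω ^ 2)) ∂μ := by
          refine lintegral_mono_ae ?_
          filter_upwards [hzero] with ω hω
          rw [← Finset.sum_congr rfl fun i _ =>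
            ENNReal.ofReal_mul (div_nonneg (v i).coe_nonneg hV0), ← ENNReal.ofReal_sum_of_nonneg fun i _ =>
            mul_nonneg (div_nonneg (v i).coe_nonneg hV0) (Real.exp_pos _).le]
          refine ENNReal.ofReal_le_ofReal ?_
          -- The weights `v i / V` equalize the terms: each one becomes a squared variable with `r V
          -- / v i * v i = r V ≤ 1/4`.
          have hj := convexOn_exp.map_sum_le (t := Finset.univ) (w := fun i => (v i : ℝ) / V)
            (p := fun i => r * V / v i * W i ω ^ 2) (fun i _ => div_nonneg (v i).coe_nonneg hV0) hsum
            (fun _ _ => Set.mem_univ _)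
          simp only [smul_eq_mul] at hj
          refine le_trans (le_of_eq ?_) hj
          rw [Finset.mul_sum]
          congr 1
          refine Finset.sum_congr rfl fun i _ => ?_
          by_cases hi : v i = 0
          · simp [hω i hi]
          · have : (v i : ℝ) ≠ 0 := by exact_mod_cast hi
            field_simp
      _ = ∑ i, ENNReal.ofReal (v i / V) *
            ∫⁻ ω, ENNReal.ofReal (Real.exp (r * V / v i * W i ω ^ 2)) ∂μ := by
          have hae : ∀ i, AEMeasurable
              (fun ω => ENNReal.ofReal (Real.exp (r * V / v i * W i ω ^ 2))) μ := fun i => by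
            have := (hW i).aemeasurable
            fun_prop
          rw [lintegral_finsetSum' _ fun i _ => (hae i).const_mul _]
          exact Finset.sum_congr rfl fun i _ => lintegral_const_mul'' _ (hae i)
      _ ≤ ∑ i, ENNReal.ofReal (v i / V) * 2 := by
          gcongr with i
          refine lintegral_exp_sq_le (hW i) (by positivity) ?_
          by_cases hi : v i = 0
          · simp [hi]
          · have : (v i : ℝ) ≠ 0 := by exact_mod_cast hi
            field_simp
            linarith
      _ = 2 := by
          rw [← Finset.sum_mul, ← ENNReal.ofReal_sum_of_nonneg fun i _ =>
            div_nonneg (v i).coe_nonneg hV0, hsum]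
          simp

/-- Exponential moment of an off-diagonal quadratic form in independent sub-Gaussian variables. -/
lemma lintegral_exp_offDiag_le [IsProbabilityMeasure μ] {N : ℕ} {X : Fin N → Ω → ℝ} {c : ℝ≥0}
    (hm : ∀ i, Measurable (X i)) (hind : iIndepFun X μ)
    (hsub : ∀ i, HasSubgaussianMGF (X i) c μ)
    (b : Fin N → Fin N → ℝ) (hb : ∀ i j, j ≤ i → b i j = 0)
    (hbc : (c : ℝ) ^ 2 * ∑ i, ∑ j, b i j ^ 2 ≤ 1 / 8) :
    ∫⁻ ω, ENNReal.ofReal (Real.exp (∑ i, X i ω * ∑ j, b i j * X j ω)) ∂μ ≤ 2 := by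
  have hlin : ∀ i, HasSubgaussianMGF (fun ω => ∑ j, b i j * X j ω)
      (∑ j, (b i j ^ 2).toNNReal * c) μ := fun i => by
    have hi : iIndepFun (fun j ω => b i j * X j ω) μ :=
      hind.comp (fun j x => b i j * x) fun j => by fun_prop
    refine HasSubgaussianMGF.sum_of_iIndepFun hi fun j _ => ?_
    rw [Real.toNNReal_of_nonneg (sq_nonneg _)]
    exact (hsub j).const_mul (b i j)
  -- The form is doubled because it is separated from its compensator by `exp q ≤ (exp (2 (q - c s))
  -- + exp (2 c s)) / 2`, where `s` is the sum of the squared linear forms.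
  have h1 := lintegral_exp_triangular_le hm hind hsub (fun i j => 2 * b i j)
    (fun i j hij => by simp [hb i j hij])
  have h2 := lintegral_exp_sum_sq_le hlin (r := 2 * c) (by positivity) (by
    push_cast
    simp_rw [Real.coe_toNNReal _ (sq_nonneg _), ← Finset.sum_mul]
    nlinarith)
  calc ∫⁻ ω, ENNReal.ofReal (Real.exp (∑ i, X i ω * ∑ j, b i j * X j ω)) ∂μ
      ≤ ∫⁻ ω, (ENNReal.ofReal (Real.exp (∑ i, (X i ω * (∑ j, 2 * b i j * X j ω)
          - c / 2 * (∑ j, 2 * b i j * X j ω) ^ 2))) +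
          ENNReal.ofReal (Real.exp (2 * c * ∑ i, (∑ j, b i j * X j ω) ^ 2))) / 2 ∂μ := by
        refine lintegral_mono fun ω => ?_
        dsimp only
        rw [← ENNReal.ofReal_add (Real.exp_pos _).le (Real.exp_pos _).le,
          show (2 : ℝ≥0∞) = ENNReal.ofReal 2 by simp, ← ENNReal.ofReal_div_of_pos two_pos]
        refine ENNReal.ofReal_le_ofReal ?_
        set q := ∑ i, X i ω * ∑ j, b i j * X j ω with hq
        set s := ∑ i, (∑ j, b i j * X j ω) ^ 2 with hs
        have e1 : ∑ i, (X i ω * (∑ j, 2 * b i j * X j ω)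
            - c / 2 * (∑ j, 2 * b i j * X j ω) ^ 2) = 2 * (q - c * s) := by
          rw [hq, hs, Finset.mul_sum, ← Finset.sum_sub_distrib, Finset.mul_sum]
          refine Finset.sum_congr rfl fun i _ => ?_
          simp_rw [mul_assoc 2 (b i _), ← Finset.mul_sum]
          ring
        rw [e1, show q = (q - c * s) + c * s by ring, Real.exp_add,
          show q - c * s + c * s - c * s = q - c * s by ring,
          show 2 * (q - c * s) = (q - c * s) + (q - c * s) by ring,
          show 2 * c * s = c * s + c * s by ring, Real.exp_add (q - c * s), Real.exp_add (c * s)]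
        nlinarith [sq_nonneg (Real.exp (q - c * s) - Real.exp (c * s))]
    _ ≤ (1 + 2) / 2 := by
        simp_rw [ENNReal.div_eq_inv_mul]
        rw [lintegral_const_mul _ (by fun_prop), lintegral_add_left (by fun_prop)]
        gcongr
    _ ≤ 2 := by
        rw [ENNReal.div_le_iff (by simp) (by simp)]
        norm_num

end Consistency
end

/-! ### Centered squares and the Hanson–Wright inequality. -/

noncomputable section
namespace Consistency

open scoped ENNReal NNReal

variable {Ω : Type*} {mΩ : MeasurableSpace Ω} {μ : Measure Ω}

/-- Second-order Taylor remainder. For a centered variable the linear term integrates to zero,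
leaving a quadratic bound on the moment generating function. -/
lemma exp_le_one_add_add_sq_mul_exp_abs (u : ℝ) :
    Real.exp u ≤ 1 + u + u ^ 2 * Real.exp |u| := by
  have h := Complex.norm_exp_sub_sum_le_norm_mul_exp (u : ℂ) 2
  simp only [Finset.sum_range_succ, Finset.sum_range_zero, pow_zero, Nat.factorial, pow_one,
    zero_add, Nat.cast_one, div_one, mul_one, Complex.norm_real, Real.norm_eq_abs, sq_abs] at h
  rw [← Complex.ofReal_exp, ← Complex.ofReal_one, ← Complex.ofReal_add, ← Complex.ofReal_sub,
    Complex.norm_real, Real.norm_eq_abs] at h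
  linarith [le_abs_self (Real.exp u - (1 + u))]

lemma integrable_exp_sq [IsProbabilityMeasure μ] {X : Ω → ℝ} {c : ℝ≥0}
    (h : HasSubgaussianMGF X c μ) {r : ℝ} (hr : 0 ≤ r) (hrc : r * c ≤ 1 / 4) :
    Integrable (fun ω => Real.exp (r * X ω ^ 2)) μ ∧ ∫ ω, Real.exp (r * X ω ^ 2) ∂μ ≤ 2 := by
  have hX := h.aemeasurable
  have hle := lintegral_exp_sq_le h hr hrc
  have hint : Integrable (fun ω => Real.exp (r * X ω ^ 2)) μ :=
    (lintegral_ofReal_ne_top_iff_integrable (by fun_prop)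
      (ae_of_all _ fun _ => (Real.exp_pos _).le)).mp
      (ne_top_of_le_ne_top (by simp) hle)
  refine ⟨hint, ?_⟩
  rw [← ofReal_integral_eq_lintegral_ofReal hint (ae_of_all _ fun _ => (Real.exp_pos _).le),
    show (2 : ℝ≥0∞) = ENNReal.ofReal 2 by simp] at hle
  exact (ENNReal.ofReal_le_ofReal_iff (by norm_num)).mp hle

lemma integrable_sq_of_subgaussian {X : Ω → ℝ} {c : ℝ≥0}
    (h : HasSubgaussianMGF X c μ) : Integrable (fun ω => X ω ^ 2) μ :=
  (h.memLp 2).integrable_sq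

lemma integral_sq_le_of_subgaussian [IsProbabilityMeasure μ] {X : Ω → ℝ} {c : ℝ≥0} (hc : 0 < c)
    (h : HasSubgaussianMGF X c μ) : ∫ ω, X ω ^ 2 ∂μ ≤ 4 * c := by
  have hc' : (0 : ℝ) < c := by exact_mod_cast hc
  obtain ⟨hint, hle⟩ := integrable_exp_sq h (r := 1 / (4 * c)) (by positivity)
    (le_of_eq (by field_simp))
  have h1 : ∫ ω, 1 / (4 * c) * X ω ^ 2 + 1 ∂μ ≤ 2 := by
    refine le_trans (integral_mono ?_ hint fun ω => Real.add_one_le_exp _) hle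
    exact ((integrable_sq_of_subgaussian h).const_mul _).add (integrable_const _)
  rw [integral_add ((integrable_sq_of_subgaussian h).const_mul _) (integrable_const _),
    integral_const_mul] at h1
  simp only [integral_const, probReal_univ, smul_eq_mul, mul_one] at h1
  have h2 : 1 / (4 * (c : ℝ)) * ∫ ω, X ω ^ 2 ∂μ ≤ 1 := by linarith
  rwa [one_div, inv_mul_le_iff₀ (by positivity), mul_one] at h2

/-- The centered square of a sub-Gaussian variable is sub-exponential. -/
lemma integrable_exp_centered_sq [IsProbabilityMeasure μ] {X : Ω → ℝ} {c : ℝ≥0} (hc : 0 < c)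
    (h : HasSubgaussianMGF X c μ) {s : ℝ} (hs : |s| * (16 * c) ≤ 1) :
    Integrable (fun ω => Real.exp (s * (X ω ^ 2 - ∫ ω, X ω ^ 2 ∂μ))) μ ∧
    ∫ ω, Real.exp (s * (X ω ^ 2 - ∫ ω, X ω ^ 2 ∂μ)) ∂μ ≤ Real.exp (2048 * c ^ 2 * s ^ 2) := by
  have hc' : (0 : ℝ) < c := by exact_mod_cast hc
  set m := ∫ ω, X ω ^ 2 ∂μ with hm
  have hm0 : 0 ≤ m := integral_nonneg fun ω => sq_nonneg _
  have hm4 : m ≤ 4 * c := integral_sq_le_of_subgaussian hc h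
  have hX := h.aemeasurable
  obtain ⟨hint, hle⟩ := integrable_exp_sq h (r := 1 / (8 * c)) (by positivity)
    (by rw [div_mul_eq_mul_div, div_le_iff₀ (by positivity)]; linarith)
  have hV : Integrable (fun ω => s * (X ω ^ 2 - m)) μ :=
    ((integrable_sq_of_subgaussian h).sub (integrable_const _)).const_mul _
  have hpt : ∀ ω, Real.exp (s * (X ω ^ 2 - m)) ≤
      1 + s * (X ω ^ 2 - m) + 1024 * c ^ 2 * s ^ 2 * Real.exp (1 / (8 * c) * X ω ^ 2) := by
    intro ω
    refine (exp_le_one_add_add_sq_mul_exp_abs _).trans ?_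
    set V := X ω ^ 2 - m with hVdef
    have hVabs : |V| ≤ X ω ^ 2 + 4 * c :=
      abs_le.mpr ⟨by nlinarith [sq_nonneg (X ω)], by nlinarith [sq_nonneg (X ω)]⟩
    -- This `w` dominates `|s V|`. One factor `exp w` absorbs `w²`, another bounds `exp |s V|`, and
    -- their product is controlled since `2 w ≤ 1/2 + X²/(8c)`.
    set w := |V| / (16 * c) with hw
    have hw0 : 0 ≤ w := by positivity
    have hVw : |V| = 16 * c * w := by rw [hw]; field_simp
    have hsV : |s * V| ≤ w := by
      rw [abs_mul, hVw]
      nlinarith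
    have hsq : (s * V) ^ 2 = 256 * c ^ 2 * s ^ 2 * w ^ 2 := by
      rw [mul_pow, ← sq_abs V, hVw]; ring
    have hw2 : w ^ 2 ≤ 2 * Real.exp w := by
      have := Real.quadratic_le_exp_of_nonneg hw0
      linarith
    have hexp : Real.exp w * Real.exp w ≤ 2 * Real.exp (1 / (8 * c) * X ω ^ 2) := by
      have h1 : Real.exp (1 / 2) ≤ 2 := by
        have := Real.exp_one_lt_d9
        have h2 : Real.exp (1 / 2) * Real.exp (1 / 2) = Real.exp 1 := by
          rw [← Real.exp_add]; norm_num
        nlinarith [Real.exp_pos (1 / 2)]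
      calc Real.exp w * Real.exp w = Real.exp (w + w) := (Real.exp_add _ _).symm
        _ ≤ Real.exp (1 / 2 + 1 / (8 * c) * X ω ^ 2) := by
          refine Real.exp_le_exp.mpr ?_
          have : w ≤ (X ω ^ 2 + 4 * c) / (16 * c) := by rw [hw]; gcongr
          calc w + w ≤ (X ω ^ 2 + 4 * c) / (16 * c) + (X ω ^ 2 + 4 * c) / (16 * c) :=
                add_le_add this this
            _ = _ := by field_simp; ring
        _ = Real.exp (1 / 2) * Real.exp (1 / (8 * c) * X ω ^ 2) := Real.exp_add _ _
        _ ≤ _ := by gcongr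
    have h5 : (s * V) ^ 2 * Real.exp |s * V| ≤
        1024 * c ^ 2 * s ^ 2 * Real.exp (1 / (8 * c) * X ω ^ 2) := by
      calc (s * V) ^ 2 * Real.exp |s * V|
          ≤ (256 * c ^ 2 * s ^ 2 * (2 * Real.exp w)) * Real.exp w := by
            rw [hsq]; gcongr
        _ = 512 * c ^ 2 * s ^ 2 * (Real.exp w * Real.exp w) := by ring
        _ ≤ 512 * c ^ 2 * s ^ 2 * (2 * Real.exp (1 / (8 * c) * X ω ^ 2)) := by gcongr
        _ = _ := by ring
    linarith
  have hint1 : Integrable (fun ω => 1 + s * (X ω ^ 2 - m)) μ := (integrable_const _).add hV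
  have hint2 := hint.const_mul (1024 * c ^ 2 * s ^ 2)
  have hint3 : Integrable (fun ω => Real.exp (s * (X ω ^ 2 - m))) μ := by
    refine Integrable.mono' (hint1.add hint2) (by fun_prop) (ae_of_all _ fun ω => ?_)
    rw [Real.norm_eq_abs, abs_of_pos (Real.exp_pos _)]
    exact hpt ω
  refine ⟨hint3, ?_⟩
  calc ∫ ω, Real.exp (s * (X ω ^ 2 - m)) ∂μ
      ≤ ∫ ω, (1 + s * (X ω ^ 2 - m)) +
          1024 * c ^ 2 * s ^ 2 * Real.exp (1 / (8 * c) * X ω ^ 2) ∂μ :=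
        integral_mono hint3 (hint1.add hint2) hpt
    _ = 1 + 1024 * c ^ 2 * s ^ 2 * ∫ ω, Real.exp (1 / (8 * c) * X ω ^ 2) ∂μ := by
        rw [integral_add hint1 hint2, integral_add (integrable_const _) hV, integral_const_mul,
          integral_sub (integrable_sq_of_subgaussian h) (integrable_const _), integral_const_mul]
        simp [← hm]
    _ ≤ 1 + 1024 * c ^ 2 * s ^ 2 * 2 := by gcongr
    _ ≤ _ := by
        have := Real.add_one_le_exp (2048 * (c : ℝ) ^ 2 * s ^ 2)
        linarith

/-- The hypothesis on `s` serves twice: it puts each `s * a i` in the range of the single-variable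
bound, and it makes the total exponent at most `1/2`, where `exp (1/2) ≤ 2`. -/
lemma lintegral_exp_diag_le [IsProbabilityMeasure μ] {ι : Type*} [Fintype ι] {X : ι → Ω → ℝ}
    {c : ℝ≥0} (hc : 0 < c) (hm : ∀ i, Measurable (X i)) (hind : iIndepFun X μ)
    (hsub : ∀ i, HasSubgaussianMGF (X i) c μ) {a : ι → ℝ} {s : ℝ}
    (ha : 4096 * (c : ℝ) ^ 2 * s ^ 2 * ∑ i, a i ^ 2 ≤ 1) :
    ∫⁻ ω, ENNReal.ofReal (Real.exp (s * ∑ i, a i * (X i ω ^ 2 - ∫ ω, X i ω ^ 2 ∂μ))) ∂μ ≤ 2 := by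
  have hc' : (0 : ℝ) < c := by exact_mod_cast hc
  have hsmall : ∀ i, |s * a i| * (16 * c) ≤ 1 := fun i => by
    have h1 : a i ^ 2 ≤ ∑ i, a i ^ 2 :=
      Finset.single_le_sum (f := fun i => a i ^ 2) (fun i _ => sq_nonneg _) (Finset.mem_univ i)
    have h2 : 4096 * (c : ℝ) ^ 2 * s ^ 2 * a i ^ 2 ≤ 1 :=
      le_trans (mul_le_mul_of_nonneg_left h1 (by positivity)) ha
    refine abs_le_of_sq_le_sq' (a := |s * a i| * (16 * c)) (b := 1) ?_ zero_le_one |>.2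
    rw [mul_pow, sq_abs]
    nlinarith [sq_nonneg ((c : ℝ) * s * a i)]
  set V : ι → Ω → ℝ := fun i ω => a i * (X i ω ^ 2 - ∫ ω, X i ω ^ 2 ∂μ) with hV
  have hVm : ∀ i, Measurable (V i) := fun i => by
    have := hm i
    fun_prop
  have hVind : iIndepFun V μ :=
    hind.comp (fun i x => a i * (x ^ 2 - ∫ ω, X i ω ^ 2 ∂μ)) fun i => by fun_prop
  have hi := fun i => integrable_exp_centered_sq hc (hsub i) (hsmall i)
  have hVint : ∀ i, Integrable (fun ω => Real.exp (s * V i ω)) μ := fun i => by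
    simpa only [hV, mul_assoc] using (hi i).1
  have hVle : ∀ i, mgf (V i) μ s ≤ Real.exp (2048 * c ^ 2 * (s * a i) ^ 2) := fun i => by
    simpa only [mgf, hV, mul_assoc] using (hi i).2
  have hsumint := hVind.integrable_exp_mul_sum hVm (s := Finset.univ) (t := s) fun i _ => hVint i
  have hmgf := hVind.mgf_sum (t := s) hVm Finset.univ
  simp only [Finset.sum_apply] at hsumint
  rw [← ofReal_integral_eq_lintegral_ofReal hsumint (ae_of_all _ fun _ => (Real.exp_pos _).le),
    show (2 : ℝ≥0∞) = ENNReal.ofReal 2 by simp]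
  refine ENNReal.ofReal_le_ofReal ?_
  calc ∫ ω, Real.exp (s * ∑ i, V i ω) ∂μ = mgf (∑ i, V i) μ s := by simp [mgf]
    _ = ∏ i, mgf (V i) μ s := hmgf
    _ ≤ ∏ i, Real.exp (2048 * c ^ 2 * (s * a i) ^ 2) :=
        Finset.prod_le_prod (fun i _ => mgf_nonneg) fun i _ => hVle i
    _ = Real.exp (2048 * c ^ 2 * s ^ 2 * ∑ i, a i ^ 2) := by
        rw [← Real.exp_sum, Finset.mul_sum]
        congr 1
        exact Finset.sum_congr rfl fun i _ => by ring
    _ ≤ Real.exp (1 / 2) := Real.exp_le_exp.mpr (by linarith)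
    _ ≤ 2 := by
        have := Real.exp_one_lt_d9
        have h2 : Real.exp (1 / 2) * Real.exp (1 / 2) = Real.exp 1 := by
          rw [← Real.exp_add]; norm_num
        nlinarith [Real.exp_pos (1 / 2)]

/-- Two-sided Chernoff bound. -/
lemma measure_lt_mul_abs_le {X : Ω → ℝ} (hX : AEMeasurable X μ) {s : ℝ}
    (h1 : ∫⁻ ω, ENNReal.ofReal (Real.exp (s * X ω)) ∂μ ≤ 2)
    (h2 : ∫⁻ ω, ENNReal.ofReal (Real.exp (-s * X ω)) ∂μ ≤ 2) (t : ℝ) :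
    μ {ω | t < |s * X ω|} ≤ 4 * ENNReal.ofReal (Real.exp (-t)) := by
  have key : ∀ r : ℝ, ∫⁻ ω, ENNReal.ofReal (Real.exp (r * X ω)) ∂μ ≤ 2 →
      μ {ω | t < r * X ω} ≤ 2 * ENNReal.ofReal (Real.exp (-t)) := by
    intro r hr
    have hM := mul_meas_ge_le_lintegral₀ (μ := μ)
      (f := fun ω => ENNReal.ofReal (Real.exp (r * X ω))) (by fun_prop)
      (ENNReal.ofReal (Real.exp t))
    have hsub : μ {ω | t < r * X ω} ≤
        μ {ω | ENNReal.ofReal (Real.exp t) ≤ ENNReal.ofReal (Real.exp (r * X ω))} := by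
      refine measure_mono fun ω hω => ENNReal.ofReal_le_ofReal (Real.exp_le_exp.mpr ?_)
      exact le_of_lt hω
    have hpos : ENNReal.ofReal (Real.exp (-t)) * ENNReal.ofReal (Real.exp t) = 1 := by
      rw [← ENNReal.ofReal_mul (Real.exp_pos _).le, ← Real.exp_add]
      simp
    calc μ {ω | t < r * X ω} ≤ _ := hsub
      _ = ENNReal.ofReal (Real.exp (-t)) * (ENNReal.ofReal (Real.exp t) *
          μ {ω | ENNReal.ofReal (Real.exp t) ≤ ENNReal.ofReal (Real.exp (r * X ω))}) := by
          rw [← mul_assoc, hpos, one_mul]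
      _ ≤ ENNReal.ofReal (Real.exp (-t)) * 2 := by gcongr; exact hM.trans hr
      _ = _ := mul_comm _ _
  calc μ {ω | t < |s * X ω|} ≤ μ ({ω | t < s * X ω} ∪ {ω | t < -s * X ω}) := by
        refine measure_mono fun ω hω => ?_
        rcases lt_abs.mp (show t < |s * X ω| from hω) with h | h
        · exact Or.inl h
        · exact Or.inr (by simpa using h)
    _ ≤ _ := measure_union_le _ _
    _ ≤ 2 * ENNReal.ofReal (Real.exp (-t)) + 2 * ENNReal.ofReal (Real.exp (-t)) :=
        add_le_add (key s h1) (key (-s) h2)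
    _ = _ := by ring

/-- Folding the lower triangle into the upper one gives a strictly triangular `b` with squared norm
at most `2 F²`, so no decoupling is needed. The diagonal part has scale `64 c F` (`4096 = 64²`) and
the off-diagonal part `4 c F` (`2/16 = 1/8`), whence `68`; the two tails `4` add up to `8`. -/
lemma hansonWright_fin [IsProbabilityMeasure μ] {N : ℕ} {X : Fin N → Ω → ℝ}
    {c : ℝ≥0} (hc : 0 < c) (hm : ∀ i, Measurable (X i)) (hind : iIndepFun X μ)
    (hsub : ∀ i, HasSubgaussianMGF (X i) c μ) (A : Fin N → Fin N → ℝ) {F : ℝ} (hF : 0 < F)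
    (hA : ∑ i, ∑ j, A i j ^ 2 ≤ F ^ 2) (t : ℝ) :
    μ {ω | 68 * c * F * t < |∑ i, ∑ j, A i j * (X i ω * X j ω) - ∑ i, A i i * ∫ ω, X i ω ^ 2 ∂μ|}
      ≤ 8 * ENNReal.ofReal (Real.exp (-t)) := by
  have hc' : (0 : ℝ) < c := by exact_mod_cast hc
  set b : Fin N → Fin N → ℝ := fun i j => if i < j then A i j + A j i else 0 with hb
  have hb0 : ∀ i j, j ≤ i → b i j = 0 := fun i j hij => if_neg (not_lt.mpr hij)
  set D : Ω → ℝ := fun ω => ∑ i, A i i * (X i ω ^ 2 - ∫ ω, X i ω ^ 2 ∂μ) with hD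
  set O : Ω → ℝ := fun ω => ∑ i, X i ω * ∑ j, b i j * X j ω with hO
  have hdecomp : ∀ ω, ∑ i, ∑ j, A i j * (X i ω * X j ω) - ∑ i, A i i * ∫ ω, X i ω ^ 2 ∂μ
      = D ω + O ω := by
    intro ω
    have h1 : ∑ i, ∑ j, A i j * (X i ω * X j ω) = ∑ i, A i i * X i ω ^ 2 + O ω := by
      have e1 : ∀ i j, A i j * (X i ω * X j ω) =
          (if i = j then A i j * (X i ω * X j ω) else 0) +
          (if i < j then A i j * (X i ω * X j ω) else 0) +
          (if j < i then A i j * (X i ω * X j ω) else 0) := by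
        intro i j
        rcases lt_trichotomy i j with h | h | h
        · simp [h, h.ne, h.not_gt]
        · simp [h]
        · simp [h, h.ne', h.not_gt]
      have e2 : ∑ i, ∑ j, (if j < i then A i j * (X i ω * X j ω) else 0) =
          ∑ i, ∑ j, (if i < j then A j i * (X i ω * X j ω) else 0) := by
        rw [Finset.sum_comm]
        refine Finset.sum_congr rfl fun i _ => Finset.sum_congr rfl fun j _ => ?_
        rw [mul_comm (X j ω)]
      rw [Finset.sum_congr rfl fun i _ => Finset.sum_congr rfl fun j _ => e1 i j]
      simp only [Finset.sum_add_distrib]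
      rw [e2, add_assoc]
      congr 1
      · refine Finset.sum_congr rfl fun i _ => ?_
        simp [pow_two]
      · rw [hO, ← Finset.sum_add_distrib]
        refine Finset.sum_congr rfl fun i _ => ?_
        rw [← Finset.sum_add_distrib, Finset.mul_sum]
        refine Finset.sum_congr rfl fun j _ => ?_
        simp only [hb]
        split_ifs <;> ring
    rw [h1, hD]
    simp only [mul_sub, Finset.sum_sub_distrib]
    ring
  have hdiag : ∑ i, A i i ^ 2 ≤ F ^ 2 := by
    refine le_trans (Finset.sum_le_sum fun i _ => ?_) hA
    exact Finset.single_le_sum (f := fun j => A i j ^ 2) (fun j _ => sq_nonneg _)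
      (Finset.mem_univ i)
  have hoff : ∑ i, ∑ j, b i j ^ 2 ≤ 2 * F ^ 2 := by
    calc ∑ i, ∑ j, b i j ^ 2
        ≤ ∑ i, ∑ j, 2 * ((if i < j then A i j ^ 2 else 0) + (if i < j then A j i ^ 2 else 0)) := by
          refine Finset.sum_le_sum fun i _ => Finset.sum_le_sum fun j _ => ?_
          simp only [hb]
          split_ifs
          · nlinarith [sq_nonneg (A i j - A j i)]
          · simp
      _ = 2 * ∑ i, ∑ j, ((if i < j then A i j ^ 2 else 0) + (if j < i then A i j ^ 2 else 0)) := by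
          simp only [← Finset.mul_sum, Finset.sum_add_distrib]
          congr 2
          rw [Finset.sum_comm]
      _ ≤ 2 * ∑ i, ∑ j, A i j ^ 2 := by
          gcongr with i _ j _
          rcases lt_trichotomy i j with h | h | h
          · simp [h, h.not_gt]
          · simp [h, sq_nonneg]
          · simp [h, h.not_gt]
      _ ≤ _ := by linarith
  have hDtail : μ {ω | t < |1 / (64 * c * F) * D ω|} ≤ 4 * ENNReal.ofReal (Real.exp (-t)) := by
    have hs : ∀ s : ℝ, s ^ 2 = (1 / (64 * c * F)) ^ 2 →
        4096 * (c : ℝ) ^ 2 * s ^ 2 * ∑ i, A i i ^ 2 ≤ 1 := fun s hs => by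
      rw [hs]
      calc 4096 * (c : ℝ) ^ 2 * (1 / (64 * c * F)) ^ 2 * ∑ i, A i i ^ 2
          ≤ 4096 * (c : ℝ) ^ 2 * (1 / (64 * c * F)) ^ 2 * F ^ 2 := by gcongr
        _ = 1 := by field_simp; norm_num
    exact measure_lt_mul_abs_le (by fun_prop) (lintegral_exp_diag_le hc hm hind hsub (hs _ rfl))
      (lintegral_exp_diag_le hc hm hind hsub (hs _ (neg_sq _))) t
  have hOtail : μ {ω | t < |1 / (4 * c * F) * O ω|} ≤ 4 * ENNReal.ofReal (Real.exp (-t)) := by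
    have hs : ∀ s : ℝ, s ^ 2 = (1 / (4 * c * F)) ^ 2 →
        ∫⁻ ω, ENNReal.ofReal (Real.exp (s * O ω)) ∂μ ≤ 2 := fun s hs => by
      have := lintegral_exp_offDiag_le hm hind hsub (fun i j => s * b i j)
        (fun i j hij => by simp [hb0 i j hij]) (by
          simp only [mul_pow, ← Finset.mul_sum, hs]
          calc (c : ℝ) ^ 2 * ((1 / (4 * c * F)) ^ 2 * ∑ i, ∑ j, b i j ^ 2)
              ≤ (c : ℝ) ^ 2 * ((1 / (4 * c * F)) ^ 2 * (2 * F ^ 2)) := by gcongr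
            _ = 1 / 8 := by field_simp; norm_num)
      refine le_trans (le_of_eq ?_) this
      refine lintegral_congr fun ω => ?_
      congr 2
      rw [hO, Finset.mul_sum]
      refine Finset.sum_congr rfl fun i _ => ?_
      simp only [mul_assoc, ← Finset.mul_sum]
      ring
    exact measure_lt_mul_abs_le (by fun_prop) (hs _ rfl) (hs _ (neg_sq _)) t
  calc _ ≤ μ ({ω | t < |1 / (64 * c * F) * D ω|} ∪ {ω | t < |1 / (4 * c * F) * O ω|}) := by
        refine measure_mono fun ω hω => ?_
        simp only [Set.mem_ofPred_eq, hdecomp] at hω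
        by_contra hcon
        simp only [Set.mem_union, Set.mem_ofPred_eq, not_or, not_lt] at hcon
        obtain ⟨h1, h2⟩ := hcon
        rw [abs_mul, abs_of_pos (by positivity), one_div, inv_mul_le_iff₀ (by positivity)] at h1 h2
        have := abs_add_le (D ω) (O ω)
        linarith
    _ ≤ _ := measure_union_le _ _
    _ ≤ _ := add_le_add hDtail hOtail
    _ = _ := by ring

/-- A form of the Hanson–Wright inequality, with exponential tails at the scale of the Frobenius
norm. -/
lemma hansonWright [IsProbabilityMeasure μ] {ι : Type*} [Fintype ι] {X : ι → Ω → ℝ}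
    {c : ℝ≥0} (hc : 0 < c) (hm : ∀ i, Measurable (X i)) (hind : iIndepFun X μ)
    (hsub : ∀ i, HasSubgaussianMGF (X i) c μ) (hmean : ∀ i, ∫ ω, X i ω ∂μ = 0)
    (A : ι → ι → ℝ) {F : ℝ} (hF : 0 < F)
    (hA : ∑ i, ∑ j, A i j ^ 2 ≤ F ^ 2) (t : ℝ) :
    μ {ω | 68 * c * F * t < |∑ i, ∑ j, A i j * (X i ω * X j ω) -
        ∫ ω, ∑ i, ∑ j, A i j * (X i ω * X j ω) ∂μ|}
      ≤ 8 * ENNReal.ofReal (Real.exp (-t)) := by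
  have hL2 : ∀ i, MemLp (X i) 2 μ := fun i => (hsub i).memLp 2
  have hint : ∀ i j, Integrable (fun ω => X i ω * X j ω) μ := fun i j =>
    (hL2 i).integrable_mul (hL2 j)
  have hmeanQ : ∫ ω, ∑ i, ∑ j, A i j * (X i ω * X j ω) ∂μ
      = ∑ i, A i i * ∫ ω, X i ω ^ 2 ∂μ := by
    rw [integral_finsetSum _ fun i _ => integrable_finsetSum _ fun j _ => (hint i j).const_mul _]
    refine Finset.sum_congr rfl fun i _ => ?_
    rw [integral_finsetSum _ fun j _ => (hint i j).const_mul _]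
    simp only [integral_const_mul]
    rw [Finset.sum_eq_single i]
    · simp only [pow_two]
    · intro j _ hij
      rw [(hind.indepFun hij.symm).integral_fun_mul_eq_mul_integral
        (hm i).aestronglyMeasurable (hm j).aestronglyMeasurable, hmean i]
      simp
    · simp
  rw [hmeanQ]
  -- The triangular argument needs an ordering of the index set; an arbitrary enumeration serves.
  let e := (Fintype.equivFin ι).symm
  have hsum : ∀ f : ι → ι → ℝ, ∑ i, ∑ j, f (e i) (e j) = ∑ i, ∑ j, f i j := fun f => by
    rw [← e.sum_comp]
    exact Finset.sum_congr rfl fun i _ => e.sum_comp (f (e i))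
  have h := hansonWright_fin hc (fun i => hm (e i)) (hind.precomp e.injective)
    (fun i => hsub (e i)) (fun i j => A (e i) (e j)) hF
    ((hsum fun i j => A i j ^ 2).trans_le hA) t
  have hQ := fun ω => hsum fun i j => A i j * (X i ω * X j ω)
  simpa only [hQ,
    e.sum_comp fun i => A i i * ∫ ω, X i ω ^ 2 ∂μ] using h

end Consistency
end

/-! ### Quadratic statistics of the array and their Frobenius norms. -/

noncomputable section
namespace Consistency

open scoped ENNReal NNReal Matrix

lemma sum_sq_eq_trace {m : ℕ} (V : Matrix (Fin m) (Fin m) ℝ) :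
    ∑ a, ∑ b, V a b ^ 2 = (V * Vᵀ).trace := by
  simp only [Matrix.trace, Matrix.diag, Matrix.mul_apply, Matrix.transpose_apply, pow_two]

lemma matSqrt_transpose {m : ℕ} {A : Matrix (Fin m) (Fin m) ℝ} (hA : A.PosSemidef) :
    (matSqrt A)ᵀ = matSqrt A := by
  have := (matSqrt_spec A hA).1.isHermitian.eq
  rwa [Matrix.conjTranspose_eq_transpose_of_trivial] at this

lemma PosSemidef.transpose_eq {m : ℕ} {A : Matrix (Fin m) (Fin m) ℝ} (hA : A.PosSemidef) :
    Aᵀ = A := by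
  have := hA.isHermitian.eq
  rwa [Matrix.conjTranspose_eq_transpose_of_trivial] at this

/-- The squared Frobenius norm of `Γ^{1/2} diag(w) Γ^{1/2}`. -/
lemma sum_sq_matSqrt_diagonal {m : ℕ} {A : Matrix (Fin m) (Fin m) ℝ} (hA : A.PosSemidef)
    (w : Fin m → ℝ) :
    ∑ a, ∑ b, (matSqrt A * Matrix.diagonal w * matSqrt A) a b ^ 2
      = ∑ j, ∑ j', w j * w j' * A j j' ^ 2 := by
  have hG := matSqrt_transpose hA
  have hGG := (matSqrt_spec A hA).2
  rw [sum_sq_eq_trace]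
  simp only [Matrix.transpose_mul, hG, Matrix.diagonal_transpose]
  set G := matSqrt A
  calc (G * Matrix.diagonal w * G * (G * (Matrix.diagonal w * G))).trace
      = (G * (Matrix.diagonal w * (G * G) * Matrix.diagonal w * G)).trace := by
        simp only [Matrix.mul_assoc]
    _ = (Matrix.diagonal w * (G * G) * Matrix.diagonal w * (G * G)).trace := by
        rw [Matrix.trace_mul_comm]; simp only [Matrix.mul_assoc]
    _ = ∑ j, ∑ j', w j * w j' * A j j' ^ 2 := by
        rw [hGG, Matrix.trace]
        refine Finset.sum_congr rfl fun j _ => ?_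
        rw [Matrix.diag_apply, Matrix.mul_apply]
        refine Finset.sum_congr rfl fun j' _ => ?_
        rw [Matrix.mul_diagonal, Matrix.diagonal_mul]
        have : A j' j = A j j' := congrFun (congrFun (PosSemidef.transpose_eq hA) j) j'
        rw [this]
        ring

/-- A quadratic statistic of a data array. -/
def quadStat {n m : ℕ} (u : Matrix (Fin n) (Fin n) ℝ) (w : Fin m → ℝ)
    (y : Fin n → Fin m → ℝ) : ℝ :=
  ∑ j, w j * ∑ i, ∑ i', u i i' * (y i j * y i' j)

lemma quadStat_eq_trace {n m : ℕ} (u : Matrix (Fin n) (Fin n) ℝ) (w : Fin m → ℝ)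
    (y : Matrix (Fin n) (Fin m) ℝ) :
    quadStat u w y = (Matrix.diagonal w * (yᵀ * u * y)).trace := by
  simp only [quadStat, Matrix.trace, Matrix.diag_apply, Matrix.diagonal_mul]
  refine Finset.sum_congr rfl fun j _ => ?_
  congr 1
  simp only [Matrix.mul_apply, Matrix.transpose_apply, Finset.sum_mul]
  rw [Finset.sum_comm]
  refine Finset.sum_congr rfl fun i _ => Finset.sum_congr rfl fun i' _ => ?_
  ring

/-- Cyclicity of the trace moves the outer factors onto `u` and `diag w`. The coefficient is then a
product of a row part and a column part, so its Frobenius norm factorizes. -/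
lemma quadStat_mul_mul {n m : ℕ} (u S : Matrix (Fin n) (Fin n) ℝ) (w : Fin m → ℝ)
    (G : Matrix (Fin m) (Fin m) ℝ) (z : Matrix (Fin n) (Fin m) ℝ) :
    quadStat u w (S * z * G) = ∑ p : Fin n × Fin m, ∑ p' : Fin n × Fin m,
      ((Sᵀ * u * S) p.1 p'.1 * (G * Matrix.diagonal w * Gᵀ) p'.2 p.2) *
        (z p.1 p.2 * z p'.1 p'.2) := by
  set U := Sᵀ * u * S with hU
  set V := G * Matrix.diagonal w * Gᵀ with hV
  calc quadStat u w (S * z * G)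
      = (Matrix.diagonal w * (Gᵀ * (zᵀ * U * z) * G)).trace := by
        rw [quadStat_eq_trace, hU]
        simp only [Matrix.transpose_mul, Matrix.mul_assoc]
    _ = (V * (zᵀ * U * z)).trace := by
        rw [← Matrix.mul_assoc, Matrix.trace_mul_comm, hV]
        simp only [Matrix.mul_assoc]
    _ = ∑ b', ∑ b, ∑ a', ∑ a, (U a a' * V b' b) * (z a b * z a' b') := by
        rw [Matrix.trace]
        refine Finset.sum_congr rfl fun b' _ => ?_
        rw [Matrix.diag_apply, Matrix.mul_apply]
        refine Finset.sum_congr rfl fun b _ => ?_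
        simp only [Matrix.mul_apply, Matrix.transpose_apply, Finset.mul_sum, Finset.sum_mul]
        refine Finset.sum_congr rfl fun a' _ => Finset.sum_congr rfl fun a _ => ?_
        ring
    _ = _ := by
        simp only [Fintype.sum_prod_type]
        rw [Finset.sum_comm]
        simp_rw [Finset.sum_comm (s := (Finset.univ : Finset (Fin m))) (t := (Finset.univ : Finset (Fin n)))]
        rw [Finset.sum_comm]

variable {Ω : Type*} [MeasurableSpace Ω] {μ : Measure Ω} {n d : ℕ} {M : ℝ}
  {Λ : Matrix (Fin n) (Fin n) ℝ} {Γ : Matrix (Fin (d + 1)) (Fin (d + 1)) ℝ}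
  {τ : Fin (d + 1) → ℝ} {Z Y : Fin n → Fin (d + 1) → Ω → ℝ}

lemma centered_eq_sum (h : SubGaussianProportional μ M Λ Γ τ Z Y) (i : Fin n) (j : Fin (d + 1))
    (ω : Ω) : Y i j ω - τ j = ∑ b, ∑ a, matSqrt Λ i a * matSqrt Γ b j * Z a b ω := by
  rw [h.representation]
  simp only [Matrix.mul_apply, Matrix.of_apply, add_sub_cancel_left, Finset.sum_mul]
  exact Finset.sum_congr rfl fun b _ => Finset.sum_congr rfl fun a _ => by ring

lemma memLp_centered (h : SubGaussianProportional μ M Λ Γ τ Z Y) (i : Fin n) (j : Fin (d + 1)) :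
    MemLp (fun ω => Y i j ω - τ j) 2 μ := by
  have hZ : ∀ a b, MemLp (Z a b) 2 μ := fun a b => (h.subGaussian_Z a b).memLp 2
  simp only [centered_eq_sum h]
  exact memLp_finsetSum _ fun b _ => memLp_finsetSum _ fun a _ => (hZ a b).const_mul _

lemma integral_centered_mul [IsProbabilityMeasure μ]
    (h : SubGaussianProportional μ M Λ Γ τ Z Y) (i i' : Fin n)
    (j j' : Fin (d + 1)) :
    ∫ ω, (Y i j ω - τ j) * (Y i' j' ω - τ j') ∂μ = Λ i i' * Γ j j' := by
  have hmean : ∀ i j, ∫ ω, Y i j ω ∂μ = τ j := by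
    intro i j
    have hint := (memLp_centered h i j).integrable (by norm_num)
    have h0 : ∫ ω, (Y i j ω - τ j) ∂μ = 0 := by
      simp only [centered_eq_sum h]
      have hZ : ∀ a b, Integrable (Z a b) μ := fun a b => (h.subGaussian_Z a b).integrable
      rw [integral_finsetSum _ fun b _ => integrable_finsetSum _ fun a _ => (hZ a b).const_mul _]
      refine Finset.sum_eq_zero fun b _ => ?_
      rw [integral_finsetSum _ fun a _ => (hZ a b).const_mul _]
      refine Finset.sum_eq_zero fun a _ => ?_
      rw [integral_const_mul, h.mean_Z, mul_zero]
    have h1 : ∫ ω, ((Y i j ω - τ j) + τ j) ∂μ = 0 + τ j := by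
      rw [integral_add hint (integrable_const _), h0]; simp
    simpa using h1
  rw [← h.covariance_Y, covariance, hmean, hmean]

/-- Concentration of the quadratic statistics of the centered outcomes. -/
lemma quadStat_tail [IsProbabilityMeasure μ] (hM : 0 < M)
    (h : SubGaussianProportional μ M Λ Γ τ Z Y) (u : Matrix (Fin n) (Fin n) ℝ)
    (w : Fin (d + 1) → ℝ) {F : ℝ} (hF : 0 < F)
    (hA : (∑ a, ∑ a', (matSqrt Λ * u * matSqrt Λ) a a' ^ 2) *
      (∑ j, ∑ j', w j * w j' * Γ j j' ^ 2) ≤ F ^ 2) (t : ℝ) :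
    μ {ω | 68 * M ^ 2 * F * t < |quadStat u w (fun i j => Y i j ω - τ j) -
        (∑ j, w j * Γ j j) * ∑ i, ∑ i', u i i' * Λ i i'|} ≤
      8 * ENNReal.ofReal (Real.exp (-t)) := by
  have hS := matSqrt_transpose h.posSemidef_Λ
  have hG := matSqrt_transpose h.posSemidef_Γ
  set U := matSqrt Λ * u * matSqrt Λ with hU
  set V := matSqrt Γ * Matrix.diagonal w * matSqrt Γ with hV
  have hQ : ∀ ω, quadStat u w (fun i j => Y i j ω - τ j) =
      ∑ p : Fin n × Fin (d + 1), ∑ p' : Fin n × Fin (d + 1),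
        (U p.1 p'.1 * V p'.2 p.2) * (Z p.1 p.2 ω * Z p'.1 p'.2 ω) := by
    intro ω
    have hy : (fun i j => Y i j ω - τ j) =
        matSqrt Λ * Matrix.of (fun a b => Z a b ω) * matSqrt Γ := by
      ext i j
      rw [h.representation]
      ring
    rw [hy, quadStat_mul_mul, hS, hG]
    rfl
  have hmean : ∫ ω, quadStat u w (fun i j => Y i j ω - τ j) ∂μ =
      (∑ j, w j * Γ j j) * ∑ i, ∑ i', u i i' * Λ i i' := by
    have hint : ∀ i i' j, Integrable (fun ω => (Y i j ω - τ j) * (Y i' j ω - τ j)) μ :=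
      fun i i' j => (memLp_centered h i j).integrable_mul (memLp_centered h i' j)
    have hint1 : ∀ i j, Integrable
        (fun ω => ∑ i', u i i' * ((Y i j ω - τ j) * (Y i' j ω - τ j))) μ :=
      fun i j => integrable_finsetSum _ fun i' _ => (hint i i' j).const_mul _
    have hint2 : ∀ j, Integrable
        (fun ω => ∑ i, ∑ i', u i i' * ((Y i j ω - τ j) * (Y i' j ω - τ j))) μ :=
      fun j => integrable_finsetSum _ fun i _ => hint1 i j
    simp only [quadStat]
    rw [integral_finsetSum _ fun j _ => (hint2 j).const_mul _, Finset.sum_mul]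
    refine Finset.sum_congr rfl fun j _ => ?_
    rw [integral_const_mul, mul_assoc]
    congr 1
    rw [integral_finsetSum _ fun i _ => hint1 i j, Finset.mul_sum]
    refine Finset.sum_congr rfl fun i _ => ?_
    rw [integral_finsetSum _ fun i' _ => (hint i i' j).const_mul _, Finset.mul_sum]
    refine Finset.sum_congr rfl fun i' _ => ?_
    rw [integral_const_mul, integral_centered_mul h]
    ring
  have hfrob : ∑ p : Fin n × Fin (d + 1), ∑ p' : Fin n × Fin (d + 1),
      (U p.1 p'.1 * V p'.2 p.2) ^ 2 ≤ F ^ 2 := by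
    refine le_trans (le_of_eq ?_) hA
    rw [← sum_sq_matSqrt_diagonal h.posSemidef_Γ, ← hV]
    simp only [Fintype.sum_prod_type, mul_pow]
    simp_rw [← Finset.mul_sum]
    rw [Finset.sum_mul]
    refine Finset.sum_congr rfl fun a _ => ?_
    simp_rw [← Finset.sum_mul]
    rw [← Finset.mul_sum, Finset.sum_comm]
  have hc : 0 < Real.toNNReal (M ^ 2) := Real.toNNReal_pos.mpr (by positivity)
  have hHW := hansonWright (X := fun p : Fin n × Fin (d + 1) => Z p.1 p.2) hc
    (fun p => h.measurable_Z _ _) h.indep_Z (fun p => h.subGaussian_Z _ _)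
    (fun p => h.mean_Z _ _) (fun p p' => U p.1 p'.1 * V p'.2 p.2) hF hfrob t
  rw [Real.coe_toNNReal _ (sq_nonneg M)] at hHW
  simpa only [← hQ, hmean] using hHW

end Consistency
end

/-! ### Concentration of the variance estimates and of the oracle average. -/

noncomputable section
namespace Consistency

open scoped ENNReal NNReal Matrix

lemma PosSemidef.sq_apply_le {m : ℕ} {A : Matrix (Fin m) (Fin m) ℝ} (hA : A.PosSemidef)
    (i j : Fin m) : A i j ^ 2 ≤ A i i * A j j := by
  have hS := matSqrt_transpose hA
  have hsymm : ∀ a b, matSqrt A a b = matSqrt A b a := fun a b =>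
    congrFun (congrFun hS b) a
  have hprod : ∀ a b, A a b = ∑ k, matSqrt A a k * matSqrt A b k := fun a b => by
    conv_lhs => rw [← (matSqrt_spec A hA).2]
    rw [Matrix.mul_apply]
    exact Finset.sum_congr rfl fun k _ => by rw [hsymm k b]
  rw [hprod i j, hprod i i, hprod j j]
  simp only [← pow_two]
  exact Finset.sum_mul_sq_le_sq_mul_sq _ _ _

lemma sum_sq_matSqrt_col {m : ℕ} {A : Matrix (Fin m) (Fin m) ℝ} (hA : A.PosSemidef) (i : Fin m) :
    ∑ a, matSqrt A a i ^ 2 = A i i := by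
  have hS := matSqrt_transpose hA
  conv_rhs => rw [← (matSqrt_spec A hA).2]
  rw [Matrix.mul_apply]
  refine Finset.sum_congr rfl fun k _ => ?_
  rw [pow_two, show matSqrt A k i = matSqrt A i k from congrFun (congrFun hS i) k]

lemma sum_sq_matSqrt_single {m : ℕ} {A : Matrix (Fin m) (Fin m) ℝ} (hA : A.PosSemidef)
    (i i' : Fin m) :
    ∑ a, ∑ a', (matSqrt A * (Matrix.single i i' 1 : Matrix (Fin m) (Fin m) ℝ) * matSqrt A) a a' ^ 2 = A i i * A i' i' := by
  have hS := matSqrt_transpose hA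
  have hentry : ∀ a a', (matSqrt A * (Matrix.single i i' 1 : Matrix (Fin m) (Fin m) ℝ) * matSqrt A) a a' =
      matSqrt A a i * matSqrt A a' i' := fun a a' => by
    rw [Matrix.mul_apply, Finset.sum_eq_single i']
    · rw [Matrix.mul_single_apply_same, mul_one,
        show matSqrt A i' a' = matSqrt A a' i' from congrFun (congrFun hS a') i']
    · intro b _ hb
      rw [Matrix.mul_single_apply_of_ne _ _ _ _ _ hb, zero_mul]
    · simp
  simp only [hentry, mul_pow, ← Finset.mul_sum, ← Finset.sum_mul, sum_sq_matSqrt_col hA]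

/-- Each nonzero entry satisfies `x² ≤ L² x^q`: below `1` since `q < 2`, and between `1` and `L`
since `x^q ≥ 1`. -/
lemma RowSparse.sum_sq_le {n : ℕ} {Λ : Matrix (Fin n) (Fin n) ℝ} {q κ L : ℝ}
    (hs : RowSparse Λ q κ) (hq0 : 0 ≤ q) (hq1 : q < 1) (hL : 1 ≤ L)
    (hΛ : ∀ i i', |Λ i i'| ≤ L) : ∑ i, ∑ i', Λ i i' ^ 2 ≤ n * (L ^ 2 * κ) := by
  have hrow : ∀ i, ∑ i', Λ i i' ^ 2 ≤ L ^ 2 * κ := fun i => by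
    refine le_trans ?_ (mul_le_mul_of_nonneg_left (hs i) (sq_nonneg L))
    rw [Finset.mul_sum]
    refine Finset.sum_le_sum fun i' _ => ?_
    split_ifs with h0
    · simp [h0]
    · have hx : 0 < |Λ i i'| := abs_pos.mpr h0
      rw [← sq_abs]
      rcases le_total |Λ i i'| 1 with h1 | h1
      · calc |Λ i i'| ^ 2 = |Λ i i'| ^ (2 : ℝ) := by norm_cast
          _ ≤ |Λ i i'| ^ q := Real.rpow_le_rpow_of_exponent_ge hx h1 (by linarith)
          _ ≤ L ^ 2 * |Λ i i'| ^ q :=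
            le_mul_of_one_le_left (Real.rpow_nonneg hx.le _) (one_le_pow₀ hL)
      · calc |Λ i i'| ^ 2 ≤ L ^ 2 := pow_le_pow_left₀ hx.le (hΛ i i') 2
          _ ≤ L ^ 2 * |Λ i i'| ^ q :=
            le_mul_of_one_le_right (sq_nonneg L) (Real.one_le_rpow h1 hq0)
  calc ∑ i, ∑ i', Λ i i' ^ 2 ≤ ∑ _ : Fin n, L ^ 2 * κ := Finset.sum_le_sum fun i _ => hrow i
    _ = _ := by simp

lemma RowSparse.pos {n : ℕ} {Λ : Matrix (Fin n) (Fin n) ℝ} {q κ : ℝ}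
    (hs : RowSparse Λ q κ) (i : Fin n) (hi : 0 < Λ i i) : 0 < κ := by
  refine lt_of_lt_of_le ?_ (hs i)
  refine Finset.sum_pos' (fun i' _ => ?_) ⟨i, Finset.mem_univ i, ?_⟩
  · split_ifs
    · exact le_rfl
    · exact Real.rpow_nonneg (abs_nonneg _) _
  · rw [if_neg hi.ne']
    exact Real.rpow_pos_of_pos (abs_pos.mpr hi.ne') _

lemma sum_sq_outcomeCorr {d : ℕ} {Γ : Matrix (Fin (d + 1)) (Fin (d + 1)) ℝ} (hΓ : Γ.PosSemidef) :
    ∑ j, ∑ j', outcomeCorr Γ j j' ^ 2 =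
      ∑ j : Fin d, ∑ j' : Fin d,
        1 / Γ j.succ j.succ * (1 / Γ j'.succ j'.succ) * Γ j.succ j'.succ ^ 2 :=
  sum_sq_matSqrt_diagonal (hΓ.submatrix Fin.succ) _

/-- The concentration inequality requires a strictly positive scale `F`. -/
lemma sum_sq_outcomeCorr_pos {d : ℕ} (hd : 1 ≤ d) {Γ : Matrix (Fin (d + 1)) (Fin (d + 1)) ℝ}
    (hΓ : Γ.PosSemidef) (hpos : ∀ j : Fin d, 0 < Γ j.succ j.succ) :
    0 < ∑ j, ∑ j', outcomeCorr Γ j j' ^ 2 := by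
  rw [sum_sq_outcomeCorr hΓ]
  have hnn : ∀ j j' : Fin d,
      0 ≤ 1 / Γ j.succ j.succ * (1 / Γ j'.succ j'.succ) * Γ j.succ j'.succ ^ 2 := fun j j' => by
    have := hpos j
    have := hpos j'
    positivity
  refine Finset.sum_pos' (fun j _ => Finset.sum_nonneg fun j' _ => hnn j j')
    ⟨⟨0, hd⟩, Finset.mem_univ _, ?_⟩
  refine Finset.sum_pos' (fun j' _ => hnn _ j') ⟨⟨0, hd⟩, Finset.mem_univ _, ?_⟩
  have := hpos ⟨0, hd⟩
  positivity

/-- The average over the auxiliary outcomes of the products of the outcomes of two units,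
normalized by the true column variances. -/
def lambdaTilde {n d : ℕ} (Γ : Matrix (Fin (d + 1)) (Fin (d + 1)) ℝ)
    (y : Fin n → Fin (d + 1) → ℝ) (i i' : Fin n) : ℝ :=
  (1 / (d : ℝ)) * ∑ j : Fin d, y i j.succ * y i' j.succ / Γ j.succ j.succ

variable {Ω : Type*} [MeasurableSpace Ω] {μ : Measure Ω} {n d : ℕ} {M : ℝ}
  {Λ : Matrix (Fin n) (Fin n) ℝ} {Γ : Matrix (Fin (d + 1)) (Fin (d + 1)) ℝ}
  {τ : Fin (d + 1) → ℝ} {Z Y : Fin n → Fin (d + 1) → Ω → ℝ}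

/-- This is the statistic with `u = I/n` and all weight on column `j`. The `Γ`-factor of the norm is
`1`, the `Λ`-factor is `‖Λ‖_F / n`. The center does not depend on `j`, which lets the scale cancel
later. -/
lemma gammaHat_tail [IsProbabilityMeasure μ] (hM : 0 < M) (hn : 1 ≤ n)
    (h : SubGaussianProportional μ M Λ Γ τ Z Y) {q κ L : ℝ}
    (hs : RowSparse Λ q κ) (hq0 : 0 ≤ q) (hq1 : q < 1) (hL : 1 ≤ L)
    (hΛ : ∀ i i', |Λ i i'| ≤ L) (hκ : 0 < κ) (j : Fin (d + 1)) (hj : 0 < Γ j j) (t : ℝ) :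
    μ {ω | 68 * M ^ 2 * (L * √(κ / n)) * t < |gammaHat (fun i j => Y i j ω - τ j) j / Γ j j -
        1 / n * ∑ i, Λ i i|} ≤ 8 * ENNReal.ofReal (Real.exp (-t)) := by
  have hn' : (0 : ℝ) < n := by exact_mod_cast hn
  have hF : 0 < L * √(κ / n) := by positivity
  have hq : ∀ y : Fin n → Fin (d + 1) → ℝ, gammaHat y j / Γ j j =
      quadStat (Matrix.diagonal fun _ => 1 / (n : ℝ)) (Pi.single j (1 / Γ j j)) y := fun y => by
    rw [quadStat, Finset.sum_eq_single j]
    · simp only [Pi.single_eq_same, Matrix.diagonal_apply, ite_mul, zero_mul, Finset.sum_ite_eq,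
        Finset.mem_univ, if_true, gammaHat, ← Finset.mul_sum, pow_two]
      ring
    · intro b _ hb
      simp [Pi.single_eq_of_ne hb]
    · simp
  have ht := quadStat_tail hM h (Matrix.diagonal fun _ => 1 / (n : ℝ))
    (Pi.single j (1 / Γ j j)) hF (by
      have e1 : ∑ a, ∑ a', (matSqrt Λ * (Matrix.diagonal fun _ => 1 / (n : ℝ) : Matrix (Fin n) (Fin n) ℝ) *
          matSqrt Λ) a a' ^ 2 = (1 / (n : ℝ)) ^ 2 * ∑ i, ∑ i', Λ i i' ^ 2 := by
        rw [sum_sq_matSqrt_diagonal h.posSemidef_Λ]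
        simp only [← pow_two, Finset.mul_sum]
      have e2 : ∑ k, ∑ k', (Pi.single j (1 / Γ j j) : Fin (d + 1) → ℝ) k *
          (Pi.single j (1 / Γ j j) : Fin (d + 1) → ℝ) k' * Γ k k' ^ 2 = 1 := by
        rw [Finset.sum_eq_single j, Finset.sum_eq_single j]
        · simp only [Pi.single_eq_same]
          field_simp
        · intro b _ hb
          simp [Pi.single_eq_of_ne hb]
        · simp
        · intro b _ hb
          simp [Pi.single_eq_of_ne hb]
        · simp
      rw [e1, e2, mul_one, mul_pow, Real.sq_sqrt (by positivity)]
      calc (1 / (n : ℝ)) ^ 2 * ∑ i, ∑ i', Λ i i' ^ 2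
          ≤ (1 / (n : ℝ)) ^ 2 * (n * (L ^ 2 * κ)) := by
            gcongr; exact hs.sum_sq_le hq0 hq1 hL hΛ
        _ = L ^ 2 * (κ / n) := by field_simp) t
  have e3 : ∑ k, (Pi.single j (1 / Γ j j) : Fin (d + 1) → ℝ) k * Γ k k = 1 := by
    rw [Finset.sum_eq_single j]
    · simp only [Pi.single_eq_same]
      field_simp
    · intro b _ hb
      simp [Pi.single_eq_of_ne hb]
    · simp
  have e4 : ∑ i, ∑ i', (Matrix.diagonal fun _ => 1 / (n : ℝ)) i i' * Λ i i' =
      1 / n * ∑ i, Λ i i := by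
    simp [Matrix.diagonal_apply, Finset.mul_sum]
  simpa only [hq, e3, e4, one_mul] using ht

lemma lambdaTilde_tail [IsProbabilityMeasure μ] (hM : 0 < M) (hd : 1 ≤ d)
    (h : SubGaussianProportional μ M Λ Γ τ Z Y) {L : ℝ} (hL : 1 ≤ L)
    (hΛ : ∀ i, 0 ≤ Λ i i ∧ Λ i i ≤ L) (hΓ : ∀ j : Fin d, 0 < Γ j.succ j.succ) (i i' : Fin n)
    (t : ℝ) :
    μ {ω | 68 * M ^ 2 * (L * (1 / (d : ℝ) * √(∑ j, ∑ j', outcomeCorr Γ j j' ^ 2))) * t <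
        |lambdaTilde Γ (fun i j => Y i j ω - τ j) i i' - Λ i i'|} ≤
      8 * ENNReal.ofReal (Real.exp (-t)) := by
  have hd' : (0 : ℝ) < d := by exact_mod_cast hd
  have hpos := sum_sq_outcomeCorr_pos hd h.posSemidef_Γ hΓ
  have hF : 0 < L * (1 / (d : ℝ) * √(∑ j, ∑ j', outcomeCorr Γ j j' ^ 2)) := by positivity
  -- The weight `0` on the outcome of interest reduces the `Γ`-factor to the auxiliary block, that
  -- is, to `‖Ω_d‖_F / d`.
  set w : Fin (d + 1) → ℝ := Fin.cons 0 fun j : Fin d => 1 / (d : ℝ) * (1 / Γ j.succ j.succ)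
    with hw
  have hentry : ∀ f : Fin n → Fin n → ℝ,
      ∑ a, ∑ a', (Matrix.single i i' (1 : ℝ)) a a' * f a a' = f i i' := fun f => by
    rw [Finset.sum_eq_single i, Finset.sum_eq_single i']
    · simp
    · intro b _ hb
      simp [hb.symm]
    · simp
    · intro b _ hb
      simp [hb.symm]
    · simp
  have hq : ∀ y : Fin n → Fin (d + 1) → ℝ,
      lambdaTilde Γ y i i' = quadStat (Matrix.single i i' 1) w y := fun y => by
    simp only [quadStat, hentry fun a a' => y a _ * y a' _, Fin.sum_univ_succ, hw, Fin.cons_zero,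
      Fin.cons_succ, zero_mul, zero_add, lambdaTilde, Finset.mul_sum]
    exact Finset.sum_congr rfl fun j _ => by ring
  have ht := quadStat_tail hM h (Matrix.single i i' 1) w hF (by
    have e : ∑ j, ∑ j', w j * w j' * Γ j j' ^ 2 =
        (1 / (d : ℝ)) ^ 2 * ∑ j, ∑ j', outcomeCorr Γ j j' ^ 2 := by
      rw [sum_sq_outcomeCorr h.posSemidef_Γ]
      simp only [Fin.sum_univ_succ, hw, Fin.cons_zero, Fin.cons_succ, zero_mul, mul_zero,
        Finset.sum_const_zero, zero_add, Finset.mul_sum]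
      exact Finset.sum_congr rfl fun j _ => Finset.sum_congr rfl fun j' _ => by ring
    rw [sum_sq_matSqrt_single h.posSemidef_Λ, e, mul_pow, mul_pow, Real.sq_sqrt hpos.le]
    gcongr
    rw [pow_two]
    exact mul_le_mul (hΛ i).2 (hΛ i').2 (hΛ i').1 (by linarith)) t
  have e3 : ∑ j, w j * Γ j j = 1 := by
    simp only [Fin.sum_univ_succ, hw, Fin.cons_zero, Fin.cons_succ, zero_mul, zero_add]
    calc ∑ j : Fin d, 1 / (d : ℝ) * (1 / Γ j.succ j.succ) * Γ j.succ j.succ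
        = ∑ _ : Fin d, 1 / (d : ℝ) := by
          refine Finset.sum_congr rfl fun j _ => ?_
          have := (hΓ j).ne'
          field_simp
      _ = 1 := by
          simp only [Finset.sum_const, Finset.card_univ, Fintype.card_fin, nsmul_eq_mul]
          field_simp
  simpa only [hq, e3, hentry fun a a' => Λ a a', one_mul] using ht

/-- Deterministic comparison of the estimator with its idealized version. -/
lemma estimator_error {y : Fin n → Fin (d + 1) → ℝ} {Λ : Matrix (Fin n) (Fin n) ℝ}
    {Γ : Matrix (Fin (d + 1)) (Fin (d + 1)) ℝ}
    (hΓ0 : Γ 0 0 = 1) (hΓ : ∀ j : Fin d, 0 < Γ j.succ j.succ)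
    {ℓ lam η δ L : ℝ} (hℓ : 0 < ℓ) (hlam : ℓ ≤ lam) (hηℓ : η ≤ ℓ / 2)
    (hL : ∀ i, Λ i i ≤ L)
    (hg : ∀ j, |gammaHat y j / Γ j j - lam| ≤ η)
    (hl : ∀ i i', |lambdaTilde Γ y i i' - Λ i i'| ≤ δ) :
    (∀ j : Fin d, 0 < gammaHat y j.succ) ∧
      ∀ i i', |gammaHat y 0 * lambdaHat y i i' - Λ i i'| ≤ δ + 4 * η / ℓ * (L + δ) := by
  have hη0 : 0 ≤ η := (abs_nonneg _).trans (hg 0)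
  have hglow : ∀ j, ℓ / 2 ≤ gammaHat y j / Γ j j := fun j => by
    have := (abs_le.mp (hg j)).1
    linarith
  have hpos : ∀ j : Fin d, 0 < gammaHat y j.succ := fun j => by
    have h1 : 0 < gammaHat y j.succ / Γ j.succ j.succ := lt_of_lt_of_le (by linarith) (hglow j.succ)
    exact (div_pos_iff_of_pos_right (hΓ j)).mp h1
  refine ⟨hpos, fun i i' => ?_⟩
  -- The relative error of normalizing by `γ̂_j` and rescaling by `γ̂_0`. Both quantities are within
  -- `η` of `lam` and the denominator is at least `ℓ/2`, so `|r j| ≤ 2η / (ℓ/2)`.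
  set r : Fin d → ℝ := fun j => gammaHat y 0 / (gammaHat y j.succ / Γ j.succ j.succ) - 1 with hr
  have hrabs : ∀ j, |r j| ≤ 4 * η / ℓ := fun j => by
    set g := gammaHat y j.succ / Γ j.succ j.succ with hgdef
    have hgl : ℓ / 2 ≤ g := hglow j.succ
    have hg0 : 0 < g := by linarith
    have h0 := hg 0
    rw [hΓ0, div_one] at h0
    have h1 : |gammaHat y 0 - g| ≤ 2 * η := by
      have := abs_sub_le (gammaHat y 0) lam g
      rw [abs_sub_comm lam g] at this
      linarith [hg j.succ]
    have h2 : r j = (gammaHat y 0 - g) / g := by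
      rw [hr, sub_div, div_self hg0.ne']
    rw [h2, abs_div, abs_of_pos hg0, div_le_div_iff₀ hg0 hℓ]
    nlinarith
  have hdiff : gammaHat y 0 * lambdaHat y i i' - lambdaTilde Γ y i i' =
      1 / (d : ℝ) * ∑ j, r j * (y i j.succ * y i' j.succ / Γ j.succ j.succ) := by
    have hnorm : ∀ j : Fin d, normalized y i j.succ * normalized y i' j.succ =
        y i j.succ * y i' j.succ / gammaHat y j.succ := fun j => by
      have h1 : gammaHat y j.succ ^ (-(1 / 2) : ℝ) * gammaHat y j.succ ^ (-(1 / 2) : ℝ) =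
          (gammaHat y j.succ)⁻¹ := by
        rw [← Real.rpow_add (hpos j), ← Real.rpow_neg_one]
        norm_num
      simp only [normalized]
      rw [div_eq_mul_inv (y i j.succ * y i' j.succ), ← h1]
      ring
    rw [lambdaHat, lambdaTilde, Finset.sum_congr rfl fun j _ => hnorm j, mul_left_comm, ← mul_sub,
      Finset.mul_sum, ← Finset.sum_sub_distrib]
    congr 1
    refine Finset.sum_congr rfl fun j _ => ?_
    have h1 := (hpos j).ne'
    have h2 := (hΓ j).ne'
    simp only [hr]
    field_simp
  have hbound : |gammaHat y 0 * lambdaHat y i i' - lambdaTilde Γ y i i'| ≤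
      4 * η / ℓ * (L + δ) := by
    calc |gammaHat y 0 * lambdaHat y i i' - lambdaTilde Γ y i i'|
        ≤ 1 / (d : ℝ) * ∑ j, |r j * (y i j.succ * y i' j.succ / Γ j.succ j.succ)| := by
          rw [hdiff, abs_mul, abs_of_nonneg (by positivity)]
          gcongr
          exact Finset.abs_sum_le_sum_abs _ _
      -- Bounding `|y y'|` by `(y² + y'²)/2` turns the sum into diagonal entries of `lambdaTilde`,
      -- already known to be at most `L + δ`; no bound on single outcomes is needed.
      _ ≤ 1 / (d : ℝ) * ∑ j : Fin d, 4 * η / ℓ * ((y i j.succ * y i j.succ / Γ j.succ j.succ +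
            y i' j.succ * y i' j.succ / Γ j.succ j.succ) / 2) := by
          gcongr with j
          rw [abs_mul]
          refine mul_le_mul (hrabs j) ?_ (abs_nonneg _) (by positivity)
          rw [abs_div, abs_of_pos (hΓ j), ← add_div, div_right_comm]
          refine div_le_div_of_nonneg_right ?_ (hΓ j).le
          rw [abs_le]
          constructor <;> nlinarith [sq_nonneg (y i j.succ + y i' j.succ),
            sq_nonneg (y i j.succ - y i' j.succ)]
      _ = 4 * η / ℓ * ((lambdaTilde Γ y i i + lambdaTilde Γ y i' i') / 2) := by
          simp only [lambdaTilde, ← Finset.mul_sum, ← Finset.sum_div, Finset.sum_add_distrib]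
          ring
      _ ≤ 4 * η / ℓ * (L + δ) := by
          have h1 := (abs_le.mp (hl i i)).2
          have h2 := (abs_le.mp (hl i' i')).2
          gcongr
          linarith [hL i, hL i']
  have := abs_sub_le (gammaHat y 0 * lambdaHat y i i') (lambdaTilde Γ y i i') (Λ i i')
  linarith [hl i i']

end Consistency
end

/-! ### Union bound and conclusion. -/

noncomputable section
namespace Consistency

open scoped ENNReal NNReal Matrix

variable {Ω : Type*} [MeasurableSpace Ω] {μ : Measure Ω}

/-- The failure probability of finitely many events, each of probability at most
`8 exp (-2 log x)`. -/
lemma measureReal_union_tail_le [IsProbabilityMeasure μ] {n d : ℕ} (hn : 1 ≤ n) (hd : 1 ≤ d)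
    {φ : ℝ} (hφ0 : 0 < φ) (hφ1 : φ < 1) (B₁ : Fin (d + 1) → Set Ω) (B₂ : Fin n × Fin n → Set Ω)
    (h₁ : ∀ j, μ (B₁ j) ≤ 8 * ENNReal.ofReal (Real.exp (-(2 * Real.log (n * d / φ)))))
    (h₂ : ∀ p, μ (B₂ p) ≤ 8 * ENNReal.ofReal (Real.exp (-(2 * Real.log (n * d / φ))))) :
    μ.real ((⋃ j, B₁ j) ∪ ⋃ p, B₂ p) ≤ 24 * φ := by
  have hn' : (1 : ℝ) ≤ n := by exact_mod_cast hn
  have hd' : (1 : ℝ) ≤ d := by exact_mod_cast hd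
  have hN : (1 : ℝ) ≤ n * d := one_le_mul_of_one_le_of_one_le hn' hd'
  set e : ℝ := Real.exp (-(2 * Real.log (n * d / φ))) with he
  have he' : e = (φ / (n * d)) ^ 2 := by
    rw [he, ← neg_mul, mul_comm, ← Real.rpow_def_of_pos (by positivity), ← inv_div,
      ← Real.rpow_natCast, Real.inv_rpow (by positivity), ← Real.rpow_neg (by positivity)]
    norm_num
  have hreal : ∀ B : Set Ω, μ B ≤ 8 * ENNReal.ofReal e → μ.real B ≤ 8 * e := fun B hB => by
    have := ENNReal.toReal_mono (by finiteness) hB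
    rwa [ENNReal.toReal_mul, ENNReal.toReal_ofReal (Real.exp_pos _).le] at this
  have h1 : μ.real (⋃ j, B₁ j) ≤ (d + 1) * (8 * e) := by
    calc μ.real (⋃ j, B₁ j) ≤ ∑ j, μ.real (B₁ j) := measureReal_iUnion_fintype_le _
      _ ≤ ∑ _ : Fin (d + 1), 8 * e := Finset.sum_le_sum fun j _ => hreal _ (h₁ j)
      _ = _ := by simp
  have h2 : μ.real (⋃ p, B₂ p) ≤ n * n * (8 * e) := by
    calc μ.real (⋃ p, B₂ p) ≤ ∑ p, μ.real (B₂ p) := measureReal_iUnion_fintype_le _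
      _ ≤ ∑ _ : Fin n × Fin n, 8 * e := Finset.sum_le_sum fun p _ => hreal _ (h₂ p)
      _ = _ := by simp
  -- The `n²` pairs are the reason for the factor `2` in the level `2 log (nd/φ)`: each event then
  -- costs `8 (φ/(nd))²`.
  have hcount : ((d : ℝ) + 1) + n * n ≤ 3 * (n * d) ^ 2 := by
    have a1 : (d : ℝ) ≤ (n * d) ^ 2 := by nlinarith
    have a2 : (1 : ℝ) ≤ (n * d) ^ 2 := one_le_pow₀ hN
    have a3 : (n : ℝ) * n ≤ (n * d) ^ 2 := by
      rw [← pow_two]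
      exact pow_le_pow_left₀ (by positivity) (le_mul_of_one_le_right (by positivity) hd') 2
    linarith
  calc μ.real ((⋃ j, B₁ j) ∪ ⋃ p, B₂ p) ≤ (((d : ℝ) + 1) + n * n) * (8 * e) := by
        refine (measureReal_union_le _ _).trans ?_
        linarith
    _ ≤ 3 * (n * d) ^ 2 * (8 * e) := by gcongr
    _ = 24 * φ ^ 2 := by rw [he']; field_simp; norm_num
    _ ≤ 24 * φ := by nlinarith

end Consistency
end

theorem theorem3
    (M lamMin lamMax gamMin gamMax : ℝ) (hM : 1 ≤ M)
    (hlamMin : 0 < lamMin) (hgamMin : 0 < gamMin) :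
    ∃ c C : ℝ, 0 < c ∧ c < 1 ∧ 0 < C ∧
      ∀ (Ω : Type*) [MeasurableSpace Ω] (μ : Measure Ω) [IsProbabilityMeasure μ]
        (n d : ℕ) (_ : 1 ≤ n) (_ : 1 ≤ d)
        (Λ : Matrix (Fin n) (Fin n) ℝ) (Γ : Matrix (Fin (d + 1)) (Fin (d + 1)) ℝ)
        (τ : Fin (d + 1) → ℝ) (Z Y : Fin n → Fin (d + 1) → Ω → ℝ) (q κ φ : ℝ),
        Consistency.SubGaussianProportional μ M Λ Γ τ Z Y →
        (∀ i : Fin n, lamMin ≤ Λ i i ∧ Λ i i ≤ lamMax) →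
        (∀ j : Fin d, gamMin ≤ Γ j.succ j.succ ∧ Γ j.succ j.succ ≤ gamMax) →
        0 ≤ q → q < 1 → Consistency.RowSparse Λ q κ →
        0 < φ → φ < 1 →
        Consistency.rate n d Γ κ φ < c →
        1 - C * φ < μ.real {ω |
          (∀ j : Fin d, 0 < Consistency.gammaHat (fun i j => Y i j ω - τ j) j.succ) ∧
          ∀ i i' : Fin n,
            |Consistency.gammaHat (fun i j => Y i j ω - τ j) 0 *
                Consistency.lambdaHat (fun i j => Y i j ω - τ j) i i' - Λ i i'|
              ≤ C * Consistency.rate n d Γ κ φ} := by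
  set L : ℝ := max 1 lamMax with hLdef
  have hL1 : 1 ≤ L := le_max_left _ _
  -- `136 = 68 * 2`: the Hanson–Wright constant times the `2` of the deviation level.
  set K : ℝ := 136 * M ^ 2 * L with hK
  have hM0 : 0 < M := by linarith
  have hK0 : 0 < K := by positivity
  -- The failure probability is at most `24 φ`, and `25` makes the final inequality strict; the
  -- remaining terms come from `estimator_error` with `η = δ = K ρ` and `ρ ≤ 1`.
  set C : ℝ := 25 + K + 4 * K / lamMin * (L + K) with hC
  have hC25 : 25 ≤ C := by
    have : 0 ≤ 4 * K / lamMin * (L + K) := by positivity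
    linarith
  -- The first bound gives `ρ ≤ 1`; the second gives `K ρ ≤ lamMin / 2`, which keeps the `γ̂_j` away
  -- from zero.
  refine ⟨min (1 / 2) (lamMin / (2 * K)), C, by positivity,
    (min_le_left _ _).trans_lt (by norm_num), by linarith, ?_⟩
  intro Ω _ μ _ n d hn hd Λ Γ τ Z Y q κ φ h hΛ hΓ hq0 hq1 hs hφ0 hφ1 hrate
  by_cases htriv : 1 < C * φ
  · exact lt_of_lt_of_le (by linarith) measureReal_nonneg
  have hφ : C * φ ≤ 1 := not_lt.mp htriv
  have hn' : (1 : ℝ) ≤ n := by exact_mod_cast hn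
  have hd' : (1 : ℝ) ≤ d := by exact_mod_cast hd
  have hN : (1 : ℝ) ≤ n * d := one_le_mul_of_one_le_of_one_le hn' hd'
  have hΛpos : ∀ i, 0 < Λ i i := fun i => lt_of_lt_of_le hlamMin (hΛ i).1
  have hΛL : ∀ i, Λ i i ≤ L := fun i => (hΛ i).2.trans (le_max_right _ _)
  have hΛabs : ∀ i i', |Λ i i'| ≤ L := fun i i' => by
    refine abs_le_of_sq_le_sq ?_ (by linarith)
    refine (Consistency.PosSemidef.sq_apply_le h.posSemidef_Λ i i').trans ?_
    rw [pow_two]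
    exact mul_le_mul (hΛL i) (hΛL i') (hΛpos i').le (by linarith)
  have hΓpos : ∀ j : Fin d, 0 < Γ j.succ j.succ := fun j => lt_of_lt_of_le hgamMin (hΓ j).1
  have hΓpos' : ∀ j, 0 < Γ j j := fun j => by
    refine Fin.cases ?_ hΓpos j
    rw [h.γ_zero_zero]
    exact one_pos
  have hκ : 0 < κ := hs.pos ⟨0, hn⟩ (hΛpos _)
  set ℓ : ℝ := Real.log (n * d / φ) with hℓ
  -- In the nontrivial case `C φ ≤ 1` forces `φ ≤ 1/25`, so the logarithm is at least `1` and is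
  -- bounded by its power `3/2`.
  have hℓ1 : 1 ≤ ℓ := by
    rw [hℓ, Real.le_log_iff_exp_le (by positivity), le_div_iff₀ hφ0]
    have := Real.exp_one_lt_d9
    nlinarith
  set a : ℝ := 1 / (d : ℝ) * √(∑ j, ∑ j', Consistency.outcomeCorr Γ j j' ^ 2) with ha
  set b : ℝ := √(κ / n) with hb
  have ha0 : 0 ≤ a := by positivity
  have hb0 : 0 ≤ b := by positivity
  set ρ := Consistency.rate n d Γ κ φ with hρ
  have hρeq : ρ = (a + b) * ℓ ^ (3 / 2 : ℝ) := rfl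
  have hρ1 : (a + b) * ℓ ≤ ρ := by
    rw [hρeq]
    gcongr
    calc ℓ = ℓ ^ (1 : ℝ) := (Real.rpow_one _).symm
      _ ≤ ℓ ^ (3 / 2 : ℝ) := Real.rpow_le_rpow_of_exponent_le hℓ1 (by norm_num)
  have hρ0 : 0 ≤ ρ := le_trans (by positivity) hρ1
  have hρlt1 : ρ ≤ 1 := (hrate.trans_le (min_le_left _ _)).le.trans (by norm_num)
  have hKρ : K * ρ ≤ lamMin / 2 := by
    have := (hrate.trans_le (min_le_right _ _)).le
    rw [le_div_iff₀ (by positivity)] at this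
    linarith
  set B₁ : Fin (d + 1) → Set Ω := fun j => {ω | 68 * M ^ 2 * (L * b) * (2 * ℓ) <
    |Consistency.gammaHat (fun i j => Y i j ω - τ j) j / Γ j j - 1 / n * ∑ i, Λ i i|} with hB₁
  set B₂ : Fin n × Fin n → Set Ω := fun p => {ω | 68 * M ^ 2 * (L * a) * (2 * ℓ) <
    |Consistency.lambdaTilde Γ (fun i j => Y i j ω - τ j) p.1 p.2 - Λ p.1 p.2|} with hB₂
  have hbad : μ.real ((⋃ j, B₁ j) ∪ ⋃ p, B₂ p) ≤ 24 * φ :=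
    Consistency.measureReal_union_tail_le hn hd hφ0 hφ1 B₁ B₂
      (fun j => Consistency.gammaHat_tail hM0 hn h hs hq0 hq1 hL1 hΛabs hκ j (hΓpos' j) _)
      (fun p => Consistency.lambdaTilde_tail hM0 hd h hL1
        (fun i => ⟨(hΛpos i).le, hΛL i⟩) hΓpos p.1 p.2 _)
  set G : Set Ω := {ω |
    (∀ j : Fin d, 0 < Consistency.gammaHat (fun i j => Y i j ω - τ j) j.succ) ∧
    ∀ i i' : Fin n,
      |Consistency.gammaHat (fun i j => Y i j ω - τ j) 0 *
          Consistency.lambdaHat (fun i j => Y i j ω - τ j) i i' - Λ i i'| ≤ C * ρ} with hG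
  -- Covering the space and using subadditivity bounds `μ.real G` from below without measurability
  -- of `G`.
  have hcover : (Set.univ : Set Ω) ⊆ G ∪ ((⋃ j, B₁ j) ∪ ⋃ p, B₂ p) := by
    intro ω _
    by_contra hcon
    simp only [Set.mem_union, Set.mem_iUnion, not_or, not_exists] at hcon
    obtain ⟨hω, h1, h2⟩ := hcon
    apply hω
    have hmeanlam : lamMin ≤ 1 / n * ∑ i, Λ i i := by
      have : (n : ℝ) * lamMin ≤ ∑ i, Λ i i := by
        calc (n : ℝ) * lamMin = ∑ _ : Fin n, lamMin := by simp
          _ ≤ _ := Finset.sum_le_sum fun i _ => (hΛ i).1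
      rw [one_div, le_inv_mul_iff₀ (by linarith)]
      exact this
    have hη : 68 * M ^ 2 * (L * b) * (2 * ℓ) ≤ K * ρ := by
      calc 68 * M ^ 2 * (L * b) * (2 * ℓ) = K * (b * ℓ) := by rw [hK]; ring
        _ ≤ K * ρ := by gcongr; nlinarith
    have hδ : 68 * M ^ 2 * (L * a) * (2 * ℓ) ≤ K * ρ := by
      calc 68 * M ^ 2 * (L * a) * (2 * ℓ) = K * (a * ℓ) := by rw [hK]; ring
        _ ≤ K * ρ := by gcongr; nlinarith
    obtain ⟨hpos, herr⟩ := Consistency.estimator_error (y := fun i j => Y i j ω - τ j)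
      h.γ_zero_zero hΓpos hlamMin hmeanlam hKρ hΛL
      (fun j => (not_lt.mp (h1 j)).trans hη) (fun i i' => (not_lt.mp (h2 (i, i'))).trans hδ)
    refine ⟨hpos, fun i i' => (herr i i').trans ?_⟩
    have hKK : K * ρ ≤ K := mul_le_of_le_one_right hK0.le hρlt1
    calc K * ρ + 4 * (K * ρ) / lamMin * (L + K * ρ)
        ≤ K * ρ + 4 * (K * ρ) / lamMin * (L + K) := by gcongr
      _ = (K + 4 * K / lamMin * (L + K)) * ρ := by ring
      _ ≤ C * ρ := by gcongr; linarith
  have htotal : 1 ≤ μ.real G + μ.real ((⋃ j, B₁ j) ∪ ⋃ p, B₂ p) := by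
    calc (1 : ℝ) = μ.real Set.univ := probReal_univ.symm
      _ ≤ μ.real (G ∪ ((⋃ j, B₁ j) ∪ ⋃ p, B₂ p)) := measureReal_mono hcover
      _ ≤ _ := measureReal_union_le _ _
  nlinarith
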